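/- **Setting.** Let $m=2+k\ge 2$, let $O\subset\mathbb R^2$ be open with coordinates $(x,y)=(x_1,x_2)$, $J=\mathrm{diag}(1,-1)$, $I_{m,2}=\mathrm{diag}(I_m,-I_2)$, $I_{m+1,1}=\mathrm{diag}(1,\dots,1,-1)$. Let $C_i$ (size $2\times2$) and $D_i$ (size $m\times 2$) be the matrices whose only nonzero entry is a $1$ at position $(i,i)$. All maps are smooth. The equations of isothermic surfaces for a function $u$ and a $k\times 2$ matrix function $G=(g_{li})$ are $$u_{xx}+u_{yy}+\sum_{l} g_{l1}g_{l2}=0,\qquad (g_{l1})_y=u_y\,g_{l2},\qquad (g_{l2})_x=u_x\,g_{l1}.\tag{1}$$ A triple $(F,G,B)$, where $F=(f_{ij})$ is $2\times 2$ with zero diagonal, $G=(g_{li})$ is $k\times2$ and $B=(b_{ij})$ satisfies $B^tJB=J$, solves the *$G^1_{m,1}$-system II* if $(f_{ij})_{x_i}+(f_{ji})_{x_j}+\sum_l f_{li}f_{lj}+\sum_l g_{li}g_{lj}=0$ for $i\ne j$, and $(b_{ij})_{x_l}=f_{lj}b_{il}$, $(g_{ij})_{x_l}=f_{lj}g_{il}$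 for $j\neq l$. A pair of maps $Y_1,Y_2:O\to\mathbb R^m$ *corresponds to* such a solution with adapted frame $A=(e_1,\dots,e_m):O\to O(m)$ if, with $X_1=\frac12(Y_1+Y_2)$, $X_2=\frac12(Y_2-Y_1)$, $X=(X_1,X_2)$ and $A_1=(e_1,e_2)$, $$A^{-1}dA=\sum_i\begin{pmatrix}-FC_i+C_iF^t& C_iG^t\\ -GC_i&0\end{pmatrix}dx_i,\qquad dX=-\sum_i A_1C_iB^tJ\,dx_i .$$ $(Y_1,Y_2)$ is an *isothermic pair* corresponding to a solution $(u,G)$ of (1) if this holds for some $A$ with $$F=\begin{pmatrix}0&u_x\\u_y&0\end{pmatrix},\qquad B=\begin{pmatrix}\cosh u&\sinh u\\ \sinh u&\cosh u\end{pmatrix}.$$ Equivalently $dY_1=-e^{u}(dx\,e_1+dy\,e_2)$, $dY_2=e^{-u}(-dx\,e_1+dy\,e_2)$, $de_{2+l}=g_{l1}\,dx\,e_1+g_{l2}\,dy\,e_2$ and $A$ is orthogonal. An immersion $Y:O\to\mathbb R^m$ is *isothermic* if $I=e^{2u}(dx^2+dy^2)$ and $II=\sum_l e^u(g_{l1}dx^2+g_{l2}dy^2)e_{2+l}$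 for some $u$, $G$ and some parallel orthonormal normal frame $e_3,\dots,e_m$. The sign convention for the second fundamental form is $II=\sum_\alpha\langle dY,de_\alpha\rangle e_\alpha$. For $\xi=\binom FG$ with $F$ as above, a *frame* is a map $E(x,\lambda)\in \mathrm{GL}(m+2,\mathbb C)$, smooth in $x\in O$ for each $\lambda\in\mathbb C$, with $$E^{-1}dE=\sum_i\begin{pmatrix}D_i\xi^t-\xi D_i^t&-\lambda D_iJ\\ \lambda D_i^t&-J\xi^tD_iJ+D_i^t\xi\end{pmatrix}dx_i,$$ $\overline{E(x,\bar\lambda)}=E(x,\lambda)$, $I_{m,2}E(x,\lambda)I_{m,2}=E(x,-\lambda)$ and $E^tI_{m+1,1}E=I_{m+1,1}$. For $0\ne s\in\mathbb R$ and a projection $\pi$ let $$q_{s,\pi}(\lambda)=\Big(\pi+\tfrac{\lambda-is}{\lambda+is}(I-\pi)\Big)\Big(\bar\pi+\tfrac{\lambda+is}{\lambda-is}(I-\bar\pi)\Big).$$ Let $M,\tilde M$ be surfaces in $\mathbb R^m$ with flat normal bundle, both parametrized on an open set by lines of curvature, by $Y$ and $\tilde Y$. A smooth bundle isomorphism $P:\nu(M)\to\nu(\tilde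 M)$ covering $Y(x)\mapsto\tilde Y(x)$ is a *Ribaucour transformation* if (a) $P$ maps parallel normal fields to parallel normal fields; (b) for every nonzero normal vector $\nu$ of $M$, the normal lines in the directions $\nu$ and $P\nu$ meet at a point equidistant from the base points; (c) every principal direction $v$ of $A_\nu$ is mapped by $Y\mapsto\tilde Y$ to an eigendirection of $\tilde A_{P\nu}$, and the tangent lines in these directions meet at a point equidistant from the base points. Here the meeting point may be at infinity (the lines are parallel and orthogonal to the segment joining the base points), and where $A_\nu$ is a multiple of the identity only the two coordinate directions count as principal directions. It is a *Darboux transformation* if moreover $Y\mapsto\tilde Y$ is conformal. **Theorem.** Let $(Y_1,Y_2)$ be an isothermic pair on $O$ corresponding to the solution $(u,G)$ of (1), with adapted frame $A=(e_1,\dots,e_m)$, let $F,B$ be as above, $\xi=\binom FG$, and let $E$ be a frame of $\xi$ with $E(x,0)=\mathrm{diag}(A(x),B(x))$. Let $0\neq s\in\mathbb R$, and let $W\in\mathbb R^m$, $Z\in\mathbb R^{1,1}$ be unit vectors ($|W|=1$, $z_1^2-z_2^2=1$). Put $$\begin{pmatrix}\tilde W\\ i\tilde Z\end{pmatrix}(x)=E(x,-is)^{-1}\begin{pmatrix}W\\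 iZ\end{pmatrix},\quad \hat W=\frac{\tilde W}{\|\tilde W\|},\quad \hat Z=\frac{\tilde Z}{(\tilde z_1^2-\tilde z_2^2)^{1/2}},\quad O'=\{x\in O:\tilde W(x)\neq0\}.$$ Let $\tilde\pi(x)$ be the projection onto $\mathbb C\binom{\tilde W}{i\tilde Z}(x)$, orthogonal with respect to the Hermitian form of signature $(m+1,1)$ given by $I_{m+1,1}$, let $\tilde E^\natural(x,\lambda)=E(x,\lambda)\,q_{s,\tilde\pi(x)}(\lambda)^{-1}$, and let $$\begin{pmatrix}\tilde F\\ \tilde G\end{pmatrix}=\xi-2s(\hat W\hat Z^tJ)_*,$$ where $_*$ replaces the $(1,1)$ and $(2,2)$ entries by $0$. Let $\alpha$ be the function with $\hat z_1=\varepsilon\cosh\alpha$, $\hat z_2=-\varepsilon\sinh\alpha$, $\varepsilon=\operatorname{sign}\hat z_1$ (replacing $(W,Z)$ by $(-W,-Z)$ changes only the signs of $\hat W$, $\hat Z$ and $\varepsilon$), put $\tilde u=2\alpha-u$, and set $$\tilde Y_1=Y_1+\frac2s(\hat z_1+\hat z_2)e^{u}\sum_{i=1}^m\hat w_ie_i,\qquad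 \tilde Y_2=Y_2+\frac2s(\hat z_1-\hat z_2)e^{-u}\sum_{i=1}^m\hat w_ie_i .$$ Then $O'$ is open; on $O'$ the vectors $\tilde W,\tilde Z$ are real, $\|\hat W\|=1$, $\hat z_1^2-\hat z_2^2=1$, and $\tilde E^\natural(x,0)=\mathrm{diag}(\tilde A^\natural(x),\tilde B^\natural(x))$ is real and block diagonal. Write $\tilde A^\natural=(\tilde e_1,\dots,\tilde e_m)$. On $O'$: (i) $(\tilde Y_1,\tilde Y_2)$ is an isothermic pair, and $\tilde Y_1$, $\tilde Y_2$ are isothermic immersions. (ii) $(\tilde u,\tilde G)$ solves (1), and $(\tilde Y_1,\tilde Y_2)$ corresponds to the solution $(\tilde F,\tilde G,\tilde B^\natural)$ of the $G^1_{m,1}$-system II with adapted frame $\tilde A^\natural$, where $$\tilde F=\begin{pmatrix}0&\tilde u_x\\ \tilde u_y&0\end{pmatrix},\qquad \tilde B^\natural=\begin{pmatrix}-\cosh\tilde u&-\sinh\tilde u\\ \sinh\tilde u&\cosh\tilde u\end{pmatrix}.$$ (iii) $\tilde e_3,\dots,\tilde e_m$ is a parallel orthonormal normal frame of $\tilde Y_1$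 and of $\tilde Y_2$, and the fundamental forms are $$\tilde I_1=e^{-2\tilde u}(dx^2+dy^2),\quad \widetilde{II}_1=e^{-\tilde u}\sum_{j=1}^{m-2}(\tilde g_{j1}dx^2-\tilde g_{j2}dy^2)\tilde e_{2+j},$$ $$\tilde I_2=e^{2\tilde u}(dx^2+dy^2),\quad \widetilde{II}_2=e^{\tilde u}\sum_{j=1}^{m-2}(\tilde g_{j1}dx^2+\tilde g_{j2}dy^2)\tilde e_{2+j}.$$ (iv) For $i=1,2$, the bundle morphism $P(e_\alpha(x))=\tilde e_\alpha(x)$, $3\le\alpha\le m$, covering $Y_i(x)\mapsto\tilde Y_i(x)$, is a Darboux transformation. -/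

import Mathlib

open scoped ContDiff Matrix InnerProductSpace

noncomputable section

namespace Isothermic

/-! ### Euclidean spaces and partial derivatives -/

/-- The parameter plane `ℝ²` with coordinates `(x₁, x₂) = (x, y)`. -/
abbrev Plane : Type := EuclideanSpace ℝ (Fin 2)

/-- Index set of cardinality `m = 2 + k`: the first two indices `inl 0`, `inl 1` (tangent directions
in a moving frame) followed by the last `m - 2 = k` indices (normal directions in a moving frame). -/
abbrev Idx (k : ℕ) : Type := Fin 2 ⊕ Fin k

/-- The ambient space `ℝᵐ`, `m = 2 + k`, with its Euclidean inner product. -/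
abbrev Amb (k : ℕ) : Type := EuclideanSpace ℝ (Idx k)

/-- The `i`-th coordinate vector `∂/∂xᵢ` of the parameter plane. -/
def coordVec (i : Fin 2) : Plane := EuclideanSpace.single i 1

/-- The partial derivative `∂f/∂xᵢ`. -/
def pd {T : Type*} [NormedAddCommGroup T] [NormedSpace ℝ T] (i : Fin 2) (f : Plane → T)
    (x : Plane) : T :=
  fderiv ℝ f x (coordVec i)

/-- The entrywise partial derivative `∂M/∂xᵢ` of a matrix-valued map. -/
def pdMat {T p q : Type*} [NormedAddCommGroup T] [NormedSpace ℝ T] (i : Fin 2)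
    (M : Plane → Matrix p q T) (x : Plane) : Matrix p q T :=
  Matrix.of fun a b => pd i (fun y => M y a b) x

/-- Entrywise smoothness of a matrix-valued map on a set. -/
def SmoothMatOn {T p q : Type*} [NormedAddCommGroup T] [NormedSpace ℝ T]
    (M : Plane → Matrix p q T) (O : Set Plane) : Prop :=
  ∀ a b, ContDiffOn ℝ ∞ (fun y => M y a b) O

/-! ### Constant matrices -/

/-- `J = diag(1, -1)`. -/
def J (R : Type*) [CommRing R] : Matrix (Fin 2) (Fin 2) R := Matrix.diagonal ![1, -1]

/-- `Cᵢ`: the `2 × 2` matrix whose only nonzero entry is the `(i, i)` entry, which is `1`. -/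
def C (R : Type*) [CommRing R] (i : Fin 2) : Matrix (Fin 2) (Fin 2) R := Matrix.single i i 1

/-- `Dᵢ`: the `m × 2` matrix whose only nonzero entry is the `(i, i)` entry, which is `1`. -/
def D (R : Type*) [CommRing R] (k : ℕ) (i : Fin 2) : Matrix (Idx k) (Fin 2) R :=
  Matrix.single (Sum.inl i) i 1

/-- `I_{m+1,1} = diag(1, …, 1, -1)`, of size `m + 2`. -/
def sigLorentz (k : ℕ) : Matrix (Idx k ⊕ Fin 2) (Idx k ⊕ Fin 2) ℂ :=
  Matrix.fromBlocks 1 0 0 (J ℂ)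

/-- `I_{m,2} = diag(1, …, 1, -1, -1)`, of size `m + 2`. -/
def sigCartan (k : ℕ) : Matrix (Idx k ⊕ Fin 2) (Idx k ⊕ Fin 2) ℂ :=
  Matrix.fromBlocks 1 0 0 (-1)

/-- Block diagonal complex matrix made of two real blocks. -/
def realBlocks {k : ℕ} (A : Matrix (Idx k) (Idx k) ℝ) (B : Matrix (Fin 2) (Fin 2) ℝ) :
    Matrix (Idx k ⊕ Fin 2) (Idx k ⊕ Fin 2) ℂ :=
  Matrix.fromBlocks (A.map Complex.ofReal) 0 0 (B.map Complex.ofReal)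

/-! ### The `G¹_{m,1}`-system and its frames -/

/-- The coefficient of `dxᵢ` in the Lax connection `θ_λ` of the `G¹_{m,1}`-system. -/
def lax {k : ℕ} (ξ : Matrix (Idx k) (Fin 2) ℝ) (lam : ℂ) (i : Fin 2) :
    Matrix (Idx k ⊕ Fin 2) (Idx k ⊕ Fin 2) ℂ :=
  let X : Matrix (Idx k) (Fin 2) ℂ := ξ.map Complex.ofReal
  Matrix.fromBlocks
    (D ℂ k i * Xᵀ - X * (D ℂ k i)ᵀ)
    (-(lam • (D ℂ k i * J ℂ)))
    (lam • (D ℂ k i)ᵀ)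
    (-(J ℂ * Xᵀ * D ℂ k i * J ℂ) + (D ℂ k i)ᵀ * X)

/-- `E(x, λ)` is a frame over `O` for the solution `ξ` of the `G¹_{m,1}`-system: a smooth
trivialization `E⁻¹ dE = θ_λ` of the Lax connection, for every `λ ∈ ℂ`, that satisfies the
`G¹_{m,1}`-reality condition. -/
structure IsFrame {k : ℕ} (O : Set Plane) (ξ : Plane → Matrix (Idx k) (Fin 2) ℝ)
    (E : Plane → ℂ → Matrix (Idx k ⊕ Fin 2) (Idx k ⊕ Fin 2) ℂ) : Prop where
  smooth : ∀ lam, SmoothMatOn (fun x => E x lam) O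
  trivializes : ∀ lam, ∀ x ∈ O, ∀ i, pdMat i (fun y => E y lam) x = E x lam * lax (ξ x) lam i
  real : ∀ x ∈ O, ∀ lam, (E x (starRingEnd ℂ lam)).map (starRingEnd ℂ) = E x lam
  twisted : ∀ x ∈ O, ∀ lam, sigCartan k * E x lam * sigCartan k = E x (-lam)
  orthogonal : ∀ x ∈ O, ∀ lam, (E x lam)ᵀ * sigLorentz k * E x lam = sigLorentz k

/-- `(F, G, B)` is a solution over `O` of the `G¹_{m,1}`-system II; in particular `F` has zero
diagonal and `B` is `O(1,1)`-valued. -/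
structure SolvesSystemII {k : ℕ} (O : Set Plane) (F : Plane → Matrix (Fin 2) (Fin 2) ℝ)
    (G : Plane → Matrix (Fin k) (Fin 2) ℝ) (B : Plane → Matrix (Fin 2) (Fin 2) ℝ) : Prop where
  smooth_F : SmoothMatOn F O
  smooth_G : SmoothMatOn G O
  smooth_B : SmoothMatOn B O
  diag_F : ∀ x ∈ O, ∀ i, F x i i = 0
  lorentz_B : ∀ x ∈ O, (B x)ᵀ * J ℝ * B x = J ℝ
  gauss : ∀ x ∈ O, ∀ i j, i ≠ j →
    pd i (fun y => F y i j) x + pd j (fun y => F y j i) x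
      + ∑ l, F x l i * F x l j + ∑ l, G x l i * G x l j = 0
  eq_B : ∀ x ∈ O, ∀ i j l, j ≠ l → pd l (fun y => B y i j) x = F x l j * B x i l
  eq_G : ∀ x ∈ O, ∀ i j l, j ≠ l → pd l (fun y => G y i j) x = F x l j * G x i l

/-- `(u, G)` is a solution over `O` of the Gauss-Codazzi-Ricci equations of isothermic surfaces:
`u_{xx} + u_{yy} + ∑ g_{l1} g_{l2} = 0`, `(g_{l1})_y = u_y g_{l2}`, `(g_{l2})_x = u_x g_{l1}`. -/
structure SolvesGaussCodazzi {k : ℕ} (O : Set Plane) (u : Plane → ℝ)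
    (G : Plane → Matrix (Fin k) (Fin 2) ℝ) : Prop where
  smooth_u : ContDiffOn ℝ ∞ u O
  smooth_G : SmoothMatOn G O
  gauss : ∀ x ∈ O, pd 0 (pd 0 u) x + pd 1 (pd 1 u) x + ∑ l, G x l 0 * G x l 1 = 0
  codazzi₁ : ∀ x ∈ O, ∀ l, pd 1 (fun y => G y l 0) x = pd 1 u x * G x l 1
  codazzi₂ : ∀ x ∈ O, ∀ l, pd 0 (fun y => G y l 1) x = pd 0 u x * G x l 0

/-- `F = (0, u_x; u_y, 0)`. -/
def offDiag (u : Plane → ℝ) (x : Plane) : Matrix (Fin 2) (Fin 2) ℝ := !![0, pd 0 u x; pd 1 u x, 0]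

/-- `B = (cosh u, sinh u; sinh u, cosh u)`. -/
def hypRot (u : Plane → ℝ) (x : Plane) : Matrix (Fin 2) (Fin 2) ℝ :=
  !![Real.cosh (u x), Real.sinh (u x); Real.sinh (u x), Real.cosh (u x)]

/-! ### Isothermic pairs -/

/-- The coefficient of `dxᵢ` in the flat `o(m)`-valued connection form `ω = A⁻¹ dA`. -/
def omega {k : ℕ} (F : Matrix (Fin 2) (Fin 2) ℝ) (G : Matrix (Fin k) (Fin 2) ℝ) (i : Fin 2) :
    Matrix (Idx k) (Idx k) ℝ :=
  Matrix.fromBlocks (-(F * C ℝ i) + C ℝ i * Fᵀ) (C ℝ i * Gᵀ) (-(G * C ℝ i)) 0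

/-- `X = (X₁, X₂)` is the pair of maps into `ℝᵐ` of type `O(1,1)` corresponding to the solution
`(F, G, B)` of the `G¹_{m,1}`-system II, with adapted orthonormal frame `A = (e₁, …, eₘ)`:
`A⁻¹ dA = ω` and `dX = -∑ᵢ A₁ Cᵢ Bᵗ J dxᵢ`, where `A₁` consists of the first two columns of `A`. -/
structure IsTupleFor {k : ℕ} (O : Set Plane) (X : Fin 2 → Plane → Amb k)
    (F : Plane → Matrix (Fin 2) (Fin 2) ℝ) (G : Plane → Matrix (Fin k) (Fin 2) ℝ)
    (B : Plane → Matrix (Fin 2) (Fin 2) ℝ) (A : Plane → Matrix (Idx k) (Idx k) ℝ) : Prop where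
  solves : SolvesSystemII O F G B
  smooth_X : ∀ r, ContDiffOn ℝ ∞ (X r) O
  smooth_A : SmoothMatOn A O
  orthogonal_A : ∀ x ∈ O, (A x)ᵀ * A x = 1
  dA : ∀ x ∈ O, ∀ i, pdMat i A x = A x * omega (F x) (G x) i
  dX : ∀ x ∈ O, ∀ i r a,
    pd i (X r) x a = -((A x).toCols₁ * C ℝ i * (B x)ᵀ * J ℝ) a r

/-- `(Y₁, Y₂)` is the pair `Y₁ = X₁ - X₂`, `Y₂ = X₁ + X₂` for the pair `(X₁, X₂)` of type `O(1,1)`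
corresponding to the solution `(F, G, B)` of the `G¹_{m,1}`-system II, with adapted frame `A`. -/
def IsIsothermicPairFor {k : ℕ} (O : Set Plane) (Y₁ Y₂ : Plane → Amb k)
    (F : Plane → Matrix (Fin 2) (Fin 2) ℝ) (G : Plane → Matrix (Fin k) (Fin 2) ℝ)
    (B : Plane → Matrix (Fin 2) (Fin 2) ℝ) (A : Plane → Matrix (Idx k) (Idx k) ℝ) : Prop :=
  IsTupleFor O
    ![fun x => (1 / 2 : ℝ) • (Y₁ x + Y₂ x), fun x => (1 / 2 : ℝ) • (Y₂ x - Y₁ x)] F G B A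

/-- `(Y₁, Y₂)` is an isothermic pair: it corresponds to some solution `(u, G)` of the
Gauss-Codazzi-Ricci equations of isothermic surfaces. -/
def IsIsothermicPair {k : ℕ} (O : Set Plane) (Y₁ Y₂ : Plane → Amb k) : Prop :=
  ∃ (u : Plane → ℝ) (G : Plane → Matrix (Fin k) (Fin 2) ℝ)
    (A : Plane → Matrix (Idx k) (Idx k) ℝ),
    SolvesGaussCodazzi O u G ∧ IsIsothermicPairFor O Y₁ Y₂ (offDiag u) G (hypRot u) A

/-- The `j`-th column `e_j` of a matrix-valued map, as a map into `ℝᵐ`. -/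
def column {k : ℕ} (A : Plane → Matrix (Idx k) (Idx k) ℝ) (j : Idx k) (x : Plane) : Amb k :=
  WithLp.toLp 2 fun a => A x a j

/-! ### Geometry of parametrized surfaces in `ℝᵐ` -/

/-- `Y` is a smooth immersion on `O`. -/
def IsImmersionOn {k : ℕ} (Y : Plane → Amb k) (O : Set Plane) : Prop :=
  ContDiffOn ℝ ∞ Y O ∧ ∀ x ∈ O, Function.Injective (fderiv ℝ Y x)

/-- The normal space of the surface `Y` at the parameter `x`. -/
def normalSpace {k : ℕ} (Y : Plane → Amb k) (x : Plane) : Submodule ℝ (Amb k) :=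
  (LinearMap.range (fderiv ℝ Y x).toLinearMap)ᗮ

/-- The first fundamental form, as a bilinear form on the parameter plane. -/
def firstForm {k : ℕ} (Y : Plane → Amb k) (x v w : Plane) : ℝ :=
  ⟪fderiv ℝ Y x v, fderiv ℝ Y x w⟫_ℝ

/-- The normal-bundle-valued second fundamental form, with the sign convention
`II = ∑_α ⟨dY, de_α⟩ e_α` for an orthonormal normal frame `e_α`; that is, `II(v, w)` is minus the
normal component of the second derivative `D²Y(v, w)`. -/
def secondForm {k : ℕ} (Y : Plane → Amb k) (x v w : Plane) : Amb k :=
  -(normalSpace Y x).starProjection (fderiv ℝ (fderiv ℝ Y) x v w)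

/-- `ν` is a parallel normal vector field of `Y` on `O`: the normal component of `dν` vanishes. -/
def IsParallelNormal {k : ℕ} (Y : Plane → Amb k) (O : Set Plane) (ν : Plane → Amb k) : Prop :=
  ContDiffOn ℝ ∞ ν O ∧ ∀ x ∈ O, ν x ∈ normalSpace Y x ∧
    ∀ v, (normalSpace Y x).starProjection (fderiv ℝ ν x v) = 0

/-- `e` is a parallel orthonormal frame of the normal bundle of the immersed surface `Y` on `O`. -/
def IsParallelNormalFrame {k : ℕ} (Y : Plane → Amb k) (O : Set Plane)
    (e : Fin k → Plane → Amb k) : Prop :=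
  (∀ a, IsParallelNormal Y O (e a)) ∧ ∀ x ∈ O, Orthonormal ℝ fun a => e a x

/-- The normal bundle of the immersed surface `Y` is flat on `O`. -/
def HasFlatNormalBundle {k : ℕ} (Y : Plane → Amb k) (O : Set Plane) : Prop :=
  ∀ x ∈ O, ∃ U : Set Plane, IsOpen U ∧ x ∈ U ∧ U ⊆ O ∧ ∃ e, IsParallelNormalFrame Y U e

/-- The fundamental forms of `Y` on `O` are `I = c² (dx² + dy²)` and
`II = c ∑ₗ (p_{l1} dx² + p_{l2} dy²) e_l`. -/
def HasForms {k : ℕ} (Y : Plane → Amb k) (O : Set Plane) (c : Plane → ℝ)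
    (p : Plane → Matrix (Fin k) (Fin 2) ℝ) (e : Fin k → Plane → Amb k) : Prop :=
  ∀ x ∈ O, ∀ v w : Plane,
    firstForm Y x v w = c x ^ 2 * (v 0 * w 0 + v 1 * w 1) ∧
    secondForm Y x v w = c x • ∑ l, (p x l 0 * (v 0 * w 0) + p x l 1 * (v 1 * w 1)) • e l x

/-- `Y` is an isothermic immersion on `O`: `I = e^{2u} (dx² + dy²)` and
`II = ∑ₗ e^u (g_{l1} dx² + g_{l2} dy²) e_l` with respect to a parallel orthonormal normal frame. -/
def IsIsothermic {k : ℕ} (O : Set Plane) (Y : Plane → Amb k) : Prop :=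
  IsImmersionOn Y O ∧
    ∃ (u : Plane → ℝ) (G : Plane → Matrix (Fin k) (Fin 2) ℝ) (e : Fin k → Plane → Amb k),
      ContDiffOn ℝ ∞ u O ∧ SmoothMatOn G O ∧ IsParallelNormalFrame Y O e ∧
      HasForms Y O (fun x => Real.exp (u x)) G e

/-! ### Ribaucour and Darboux transformations -/

/-- The line through `p` in direction `d` and the line through `q` in direction `dq` meet at a point
equidistant from `p` and `q`. The point is allowed to be at infinity: the lines are then parallel
and orthogonal to the segment `pq` (the common tangent sphere degenerates to a hyperplane). -/
def LinesMeetEquidistantly {k : ℕ} (p d q dq : Amb k) : Prop :=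
  (∃ t tq : ℝ, p + t • d = q + tq • dq ∧ dist (p + t • d) p = dist (p + t • d) q) ∨
    ((∃ c : ℝ, c ≠ 0 ∧ dq = c • d) ∧ ⟪q - p, d⟫_ℝ = 0)

/-- `v` (a tangent vector, in parameters) is zero or an eigenvector of the shape operator `A_ν`. -/
def IsShapeEigen {k : ℕ} (Y : Plane → Amb k) (x : Plane) (ν : Amb k) (v : Plane) : Prop :=
  ∃ κ : ℝ, ∀ w, ⟪secondForm Y x v w, ν⟫_ℝ = κ * firstForm Y x v w

/-- `v` is a principal direction of the shape operator `A_ν` of a surface parametrized by lines of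
curvature: an eigenvector of `A_ν`, where, in case `A_ν` is a multiple of the identity, only the
directions of the coordinate lines of curvature count. -/
def IsPrincipalDirection {k : ℕ} (Y : Plane → Amb k) (x : Plane) (ν : Amb k) (v : Plane) : Prop :=
  v ≠ 0 ∧ IsShapeEigen Y x ν v ∧
    ((∀ w, IsShapeEigen Y x ν w) → ∃ (i : Fin 2) (c : ℝ), v = c • coordVec i)

/-- `(x₁, x₂) ∈ O` are line of curvature coordinates of `Y`: the coordinate vectors are a common
orthogonal eigenbasis of all shape operators. -/
def IsCurvatureLineCoords {k : ℕ} (Y : Plane → Amb k) (O : Set Plane) : Prop :=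
  ∀ x ∈ O, firstForm Y x (coordVec 0) (coordVec 1) = 0 ∧
    ∀ ν ∈ normalSpace Y x, ∀ i, IsShapeEigen Y x ν (coordVec i)

/-- `P`, restricted to the normal spaces, is a Ribaucour transformation from the normal bundle of
the surface `Y` to that of `Yn`, covering the map `Y(x) ↦ Yn(x)`. Both surfaces are immersed, have
flat normal bundle, and are parametrized by lines of curvature. -/
structure IsRibaucour {k : ℕ} (O : Set Plane) (Y Yn : Plane → Amb k)
    (P : Plane → Amb k →L[ℝ] Amb k) : Prop where
  immersion : IsImmersionOn Y O
  immersion_new : IsImmersionOn Yn O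
  flat : HasFlatNormalBundle Y O
  flat_new : HasFlatNormalBundle Yn O
  coords : IsCurvatureLineCoords Y O
  coords_new : IsCurvatureLineCoords Yn O
  smooth : ContDiffOn ℝ ∞ P O
  bundle_iso : ∀ x ∈ O, Set.BijOn (P x) (normalSpace Y x) (normalSpace Yn x)
  parallel : ∀ U : Set Plane, IsOpen U → U ⊆ O → ∀ ν, IsParallelNormal Y U ν →
    IsParallelNormal Yn U fun x => P x (ν x)
  normal_lines : ∀ x ∈ O, ∀ ν ∈ normalSpace Y x, ν ≠ 0 →
    LinesMeetEquidistantly (Y x) ν (Yn x) (P x ν)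
  principal : ∀ x ∈ O, ∀ ν ∈ normalSpace Y x, ∀ v, IsPrincipalDirection Y x ν v →
    IsShapeEigen Yn x (P x ν) v
  tangent_lines : ∀ x ∈ O, ∀ ν ∈ normalSpace Y x, ∀ v, IsPrincipalDirection Y x ν v →
    LinesMeetEquidistantly (Y x) (fderiv ℝ Y x v) (Yn x) (fderiv ℝ Yn x v)

/-- A Darboux transformation: a Ribaucour transformation covering a conformal map. -/
def IsDarboux {k : ℕ} (O : Set Plane) (Y Yn : Plane → Amb k)
    (P : Plane → Amb k →L[ℝ] Amb k) : Prop :=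
  IsRibaucour O Y Yn P ∧
    ∀ x ∈ O, ∃ ρ : ℝ, 0 < ρ ∧ ∀ v w, firstForm Yn x v w = ρ * firstForm Y x v w

/-- The linear map with `e_a(x) ↦ f_a(x)` for all `a`, and zero on the orthogonal complement of
the `e_a(x)`, for `e_a(x)` orthonormal. -/
def bundleMap {k : ℕ} (e f : Fin k → Plane → Amb k) (x : Plane) : Amb k →L[ℝ] Amb k :=
  ∑ a, (innerSL ℝ (e a x)).smulRight (f a x)

/-! ### The rational map `q_{s,π}` and its action -/

/-- The orthogonal projection onto the line spanned by `p`, with respect to the form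
`⟨a, b⟩₁ = ∑ conj(aᵢ) bᵢ - conj(a_{m+2}) b_{m+2}`. -/
def projOnto {k : ℕ} (p : Idx k ⊕ Fin 2 → ℂ) : Matrix (Idx k ⊕ Fin 2) (Idx k ⊕ Fin 2) ℂ :=
  (star p ⬝ᵥ (sigLorentz k *ᵥ p))⁻¹ • Matrix.vecMulVec p (star p ᵥ* sigLorentz k)

/-- `q_{s,π}(λ) = (π + (λ - is)/(λ + is) (I - π)) (π̄ + (λ + is)/(λ - is) (I - π̄))`. -/
def qMap {k : ℕ} (s : ℝ) (π : Matrix (Idx k ⊕ Fin 2) (Idx k ⊕ Fin 2) ℂ) (lam : ℂ) :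
    Matrix (Idx k ⊕ Fin 2) (Idx k ⊕ Fin 2) ℂ :=
  (π + ((lam - Complex.I * s) / (lam + Complex.I * s)) • (1 - π)) *
    (π.map (starRingEnd ℂ) +
      ((lam + Complex.I * s) / (lam - Complex.I * s)) • (1 - π.map (starRingEnd ℂ)))

/-- The vector `(W, iZ)` in `ℂ^{m+2}`. -/
def initVec {k : ℕ} (W : Amb k) (Z : Fin 2 → ℝ) : Idx k ⊕ Fin 2 → ℂ :=
  Sum.elim (fun j => (W j : ℂ)) (fun j => Complex.I * (Z j : ℂ))

section Dressing

variable {k : ℕ} (E : Plane → ℂ → Matrix (Idx k ⊕ Fin 2) (Idx k ⊕ Fin 2) ℂ) (s : ℝ)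
  (W : Amb k) (Z : Fin 2 → ℝ)

/-- `E(x, -is)⁻¹ (W, iZ)`. -/
def movedVec (x : Plane) : Idx k ⊕ Fin 2 → ℂ := (E x (-(Complex.I * s)))⁻¹ *ᵥ initVec W Z

/-- `W̃`, where `(W̃, iZ̃) = E(x, -is)⁻¹ (W, iZ)`. -/
def tildeW (x : Plane) : Amb k := WithLp.toLp 2 fun j => (movedVec E s W Z x (Sum.inl j)).re

/-- `Z̃`, where `(W̃, iZ̃) = E(x, -is)⁻¹ (W, iZ)`. -/
def tildeZ (x : Plane) : Fin 2 → ℝ := fun j => (movedVec E s W Z x (Sum.inr j)).im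

/-- `Ŵ = W̃ / ‖W̃‖`, with the Euclidean norm of `ℝᵐ`. -/
def hatW (x : Plane) : Amb k := ‖tildeW E s W Z x‖⁻¹ • tildeW E s W Z x

/-- `Ẑ = Z̃ / ‖Z̃‖`, with the norm `(z₁² - z₂²)^{1/2}` of `ℝ^{1,1}`. -/
def hatZ (x : Plane) : Fin 2 → ℝ := fun j =>
  tildeZ E s W Z x j / Real.sqrt (tildeZ E s W Z x 0 ^ 2 - tildeZ E s W Z x 1 ^ 2)

/-- The part of `O` where `W̃ ≠ 0`, that is, where `Ŵ` and `Ẑ` are defined. -/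
def regularSet (O : Set Plane) : Set Plane := {x ∈ O | tildeW E s W Z x ≠ 0}

/-- The new frame `Ẽ♮(x, λ) = E(x, λ) q_{s,π̃(x)}(λ)⁻¹`, where `π̃(x)` is the orthogonal projection
onto the line spanned by `E(x, -is)⁻¹ (W, iZ)`. -/
def newFrame (x : Plane) (lam : ℂ) : Matrix (Idx k ⊕ Fin 2) (Idx k ⊕ Fin 2) ℂ :=
  E x lam * (qMap s (projOnto (movedVec E s W Z x)) lam)⁻¹

/-- `Ã♮`, the upper left (real) block of `Ẽ♮(x, 0)`. -/
def newA (x : Plane) : Matrix (Idx k) (Idx k) ℝ :=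
  (newFrame E s W Z x 0).toBlocks₁₁.map Complex.re

/-- `B̃♮`, the lower right (real) block of `Ẽ♮(x, 0)`. -/
def newB (x : Plane) : Matrix (Fin 2) (Fin 2) ℝ :=
  (newFrame E s W Z x 0).toBlocks₂₂.map Complex.re

/-- `ξ̃ = ξ - 2s (Ŵ Ẑᵗ J)_*`, where `_*` replaces the `(i, i)` entries by zero. -/
def newXi (ξ : Plane → Matrix (Idx k) (Fin 2) ℝ) (x : Plane) : Matrix (Idx k) (Fin 2) ℝ :=
  ξ x - (2 * s) • Matrix.of fun a j =>
    if a = Sum.inl j then 0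
    else (Matrix.vecMulVec (hatW E s W Z x).ofLp (hatZ E s W Z x) * J ℝ) a j

/-- The function `α` with `ẑ₁ = ε cosh α` and `ẑ₂ = -ε sinh α`, where `ε` is the sign of `ẑ₁`. -/
def alpha (x : Plane) : ℝ :=
  Real.arsinh (-(Real.sign (hatZ E s W Z x 0) * hatZ E s W Z x 1))

/-- `ũ = 2α - u`. -/
def newU (u : Plane → ℝ) (x : Plane) : ℝ := 2 * alpha E s W Z x - u x

/-- `Ỹ₁ = Y₁ + (2/s) (ẑ₁ + ẑ₂) e^u ∑ ŵᵢ eᵢ`, where `A = (e₁, …, eₘ)`. -/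
def newY₁ (u : Plane → ℝ) (A : Plane → Matrix (Idx k) (Idx k) ℝ) (Y₁ : Plane → Amb k)
    (x : Plane) : Amb k :=
  Y₁ x + (2 / s * (hatZ E s W Z x 0 + hatZ E s W Z x 1) * Real.exp (u x)) •
    ∑ i, hatW E s W Z x i • column A i x

/-- `Ỹ₂ = Y₂ + (2/s) (ẑ₁ - ẑ₂) e^{-u} ∑ ŵᵢ eᵢ`, where `A = (e₁, …, eₘ)`. -/
def newY₂ (u : Plane → ℝ) (A : Plane → Matrix (Idx k) (Idx k) ℝ) (Y₂ : Plane → Amb k)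
    (x : Plane) : Amb k :=
  Y₂ x + (2 / s * (hatZ E s W Z x 0 - hatZ E s W Z x 1) * Real.exp (-u x)) •
    ∑ i, hatW E s W Z x i • column A i x

end Dressing

end Isothermic

end

/-! At `λ = -is` the vector `(W̃, iZ̃)` is a constant vector seen in a parallel frame, so it solves
a linear equation. The reality conditions on `E` make `W̃` and `Z̃` real. As `E` preserves a complex
bilinear form for which `(W, iZ)` is null, `‖W̃‖² = z̃₁² - z̃₂²`. One factor therefore normalizes
both vectors, and `(w, z) = (Ŵ, Ẑ)` solves the closed real system `IsDressing`
(`IsFrame.isDressing`). After this, `λ` matters only at `0`, where `q_{s,π}` is an involution made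
of two reflections, one in `ℝᵐ` and one in `ℝ^{1,1}` (`qMap_zero`).

Geometrically, put `η = ∑ wᵢ eᵢ` and let `Jᵢ = ±1` be the diagonal entries of `J`. The new frame
consists of the vectors `eⱼ - 2 wⱼ η`, the reflections of the `eⱼ` in `η^⊥`, and the dressing
equations reduce to `∂ᵢη = s Jᵢ zᵢ (eᵢ - wᵢ η)` (`hasPd_direction`). It follows that the reflected
frame has a connection form of the same shape, with `ξ` replaced by `ξ - 2s (w zᵗ J)_*`
(`dA_reflected`), and that `Y + ρη` is again adapted to the reflected frame as soon as `ρ` solves a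
first order equation (`isAdapted_reflected`). The factors of `η` in `Ỹ₁` and `Ỹ₂` are explicit
solutions of it.

On the `ℝ^{1,1}` side `α = log |z₁ - z₂|`, so the derivatives of `ũ = 2α - u` can be computed: they
are the off-diagonal entries of the new `F`, and the Gauss-Codazzi-Ricci equations for `(ũ, G̃)`
follow by direct differentiation (`hasPd_newU`, `solvesGaussCodazzi`). The new Lax connection and
`Ẽ♮` at `λ ≠ 0` are not needed.

The Ribaucour property is elementary. The base points differ by a multiple of `η`, and corresponding
normal or tangent lines are exchanged by the reflection in `η^⊥` up to scale, so they are the legs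
of an isosceles triangle or are parallel (`linesMeetEquidistantly_reflection`). Conformality holds
because both surfaces have `|c₁| = |c₂|`, where `∂Y/∂xᵢ = cᵢ eᵢ`. -/

namespace Isothermic

/-! ### Calculus of partial derivatives -/

/-- `f` is differentiable at `x`, with partial derivative `∂f/∂xᵢ = f'`. -/
def HasPd {T : Type*} [NormedAddCommGroup T] [NormedSpace ℝ T] (i : Fin 2) (f : Plane → T) (f' : T)
    (x : Plane) : Prop :=
  ∃ L : Plane →L[ℝ] T, HasFDerivAt f L x ∧ L (coordVec i) = f'

section HasPd

variable {T : Type*} [NormedAddCommGroup T] [NormedSpace ℝ T] {i : Fin 2} {x : Plane}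
  {f g : Plane → T} {f' g' : T} {c d : Plane → ℝ} {c' d' : ℝ}

theorem HasPd.pd_eq (h : HasPd i f f' x) : pd i f x = f' := by
  obtain ⟨L, hL, rfl⟩ := h
  rw [pd, hL.fderiv]

theorem hasPd_of_differentiableAt (h : DifferentiableAt ℝ f x) : HasPd i f (pd i f x) x :=
  ⟨_, h.hasFDerivAt, rfl⟩

theorem HasPd.congr_deriv (h : HasPd i f f' x) (h' : f' = g') : HasPd i f g' x := h' ▸ h

theorem hasPd_const (v : T) : HasPd i (fun _ => v) 0 x := ⟨_, hasFDerivAt_const v x, rfl⟩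

theorem HasPd.add (hf : HasPd i f f' x) (hg : HasPd i g g' x) :
    HasPd i (fun y => f y + g y) (f' + g') x := by
  obtain ⟨L, hL, rfl⟩ := hf
  obtain ⟨M, hM, rfl⟩ := hg
  exact ⟨_, hL.add hM, rfl⟩

theorem HasPd.sub (hf : HasPd i f f' x) (hg : HasPd i g g' x) :
    HasPd i (fun y => f y - g y) (f' - g') x := by
  obtain ⟨L, hL, rfl⟩ := hf
  obtain ⟨M, hM, rfl⟩ := hg
  exact ⟨_, hL.sub hM, rfl⟩

theorem HasPd.neg (hf : HasPd i f f' x) : HasPd i (fun y => -f y) (-f') x := by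
  obtain ⟨L, hL, rfl⟩ := hf
  exact ⟨_, hL.neg, rfl⟩

theorem HasPd.sum {ι : Type*} {s : Finset ι} {f : ι → Plane → T} {f' : ι → T}
    (h : ∀ a ∈ s, HasPd i (f a) (f' a) x) :
    HasPd i (fun y => ∑ a ∈ s, f a y) (∑ a ∈ s, f' a) x := by
  classical
  induction s using Finset.induction_on with
  | empty => simpa using hasPd_const (0 : T)
  | insert a s ha ih =>
    simp only [Finset.sum_insert ha]
    exact (h a (by simp)).add (ih fun b hb => h b (by simp [hb]))

theorem HasPd.smul (hc : HasPd i c c' x) (hf : HasPd i f f' x) :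
    HasPd i (fun y => c y • f y) (c' • f x + c x • f') x := by
  obtain ⟨L, hL, rfl⟩ := hf
  obtain ⟨M, hM, rfl⟩ := hc
  exact ⟨_, hM.smul hL, by simp [add_comm]⟩

theorem HasPd.mul {𝔸 : Type*} [NormedRing 𝔸] [NormedAlgebra ℝ 𝔸] {c d : Plane → 𝔸} {c' d' : 𝔸}
    (hc : HasPd i c c' x) (hd : HasPd i d d' x) :
    HasPd i (fun y => c y * d y) (c' * d x + c x * d') x := by
  obtain ⟨L, hL, rfl⟩ := hc
  obtain ⟨M, hM, rfl⟩ := hd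
  exact ⟨_, hL.mul' hM, by simp [add_comm]⟩

theorem HasPd.clm {S : Type*} [NormedAddCommGroup S] [NormedSpace ℝ S] (L : T →L[ℝ] S)
    (hf : HasPd i f f' x) : HasPd i (fun y => L (f y)) (L f') x := by
  obtain ⟨M, hM, rfl⟩ := hf
  exact ⟨_, L.hasFDerivAt.comp x hM, rfl⟩

theorem HasPd.inner {E : Type*} [NormedAddCommGroup E] [InnerProductSpace ℝ E] {f g : Plane → E}
    {f' g' : E} (hf : HasPd i f f' x) (hg : HasPd i g g' x) :
    HasPd i (fun y => ⟪f y, g y⟫_ℝ) (⟪f', g x⟫_ℝ + ⟪f x, g'⟫_ℝ) x := by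
  obtain ⟨L, hL, rfl⟩ := hf
  obtain ⟨M, hM, rfl⟩ := hg
  exact ⟨_, hL.inner ℝ hM, by simp [add_comm]⟩

theorem HasPd.scomp {φ : ℝ → ℝ} {φ' : ℝ} (hφ : HasDerivAt φ φ' (c x)) (hc : HasPd i c c' x) :
    HasPd i (fun y => φ (c y)) (φ' * c') x := by
  obtain ⟨L, hL, rfl⟩ := hc
  exact ⟨_, hφ.comp_hasFDerivAt x hL, rfl⟩

theorem HasPd.congr_of_eventuallyEq (hf : HasPd i f f' x) (h : g =ᶠ[nhds x] f) :
    HasPd i g f' x := by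
  obtain ⟨L, hL, rfl⟩ := hf
  exact ⟨L, hL.congr_of_eventuallyEq h, rfl⟩

theorem HasPd.congr_on {O : Set Plane} (hf : HasPd i f f' x) (hO : IsOpen O) (hx : x ∈ O)
    (h : ∀ y ∈ O, g y = f y) : HasPd i g f' x :=
  hf.congr_of_eventuallyEq (Filter.eventually_of_mem (hO.mem_nhds hx) h)

theorem pd_congr_on {O : Set Plane} (hO : IsOpen O) (hx : x ∈ O)
    (h : ∀ y ∈ O, g y = f y) : pd i g x = pd i f x := by
  have : g =ᶠ[nhds x] f := Filter.eventually_of_mem (hO.mem_nhds hx) h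
  rw [pd, pd, this.fderiv_eq]

theorem hasPd_of_contDiffOn {O : Set Plane} (hf : ContDiffOn ℝ ∞ f O) (hO : IsOpen O)
    (hx : x ∈ O) : HasPd i f (pd i f x) x :=
  hasPd_of_differentiableAt ((hf.contDiffAt (hO.mem_nhds hx)).differentiableAt (by simp))

theorem fderiv_eq_sum_pd (f : Plane → T) (x v : Plane) :
    fderiv ℝ f x v = ∑ i, v i • pd i f x := by
  have hv : v = ∑ i, v i • coordVec i := by
    ext j
    fin_cases j <;> simp [coordVec]
  conv_lhs => rw [hv]
  simp [pd]

theorem contDiffOn_pd {O : Set Plane} (hf : ContDiffOn ℝ ∞ f O) (hO : IsOpen O) (i : Fin 2) :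
    ContDiffOn ℝ ∞ (pd i f) O :=
  (hf.fderiv_of_isOpen hO (m := ∞) (by simp)).clm_apply contDiffOn_const

theorem hasPd_toLp {ι : Type*} [Fintype ι] {f : ι → Plane → ℝ} {f' : ι → ℝ}
    (h : ∀ a, HasPd i (f a) (f' a) x) :
    HasPd i (fun y => (WithLp.toLp 2 fun a => f a y : EuclideanSpace ℝ ι)) (WithLp.toLp 2 f') x := by
  choose L hL hL' using h
  refine ⟨((PiLp.continuousLinearEquiv 2 ℝ fun _ : ι => ℝ).symm : (ι → ℝ) →L[ℝ] _) ∘L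
    ContinuousLinearMap.pi L, ?_, ?_⟩
  · rw [← hasFDerivWithinAt_univ]
    exact hasFDerivWithinAt_euclidean.2 fun a => (hL a).hasFDerivWithinAt
  · ext a
    simp [hL']

theorem HasPd.apply {ι : Type*} [Fintype ι] {f : Plane → EuclideanSpace ℝ ι}
    {f' : EuclideanSpace ℝ ι} (h : HasPd i f f' x) (a : ι) : HasPd i (fun y => f y a) (f' a) x :=
  h.clm (EuclideanSpace.proj a)

end HasPd

theorem contDiffOn_toLp {ι : Type*} [Fintype ι] {f : ι → Plane → ℝ} {O : Set Plane}
    (h : ∀ a, ContDiffOn ℝ ∞ (f a) O) :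
    ContDiffOn ℝ ∞ (fun y => (WithLp.toLp 2 fun a => f a y : EuclideanSpace ℝ ι)) O :=
  contDiffOn_euclidean.2 h

/-! ### Surfaces with an adapted orthonormal frame along lines of curvature -/

theorem inner_column {k : ℕ} {A : Plane → Matrix (Idx k) (Idx k) ℝ} {x : Plane}
    (hA : (A x)ᵀ * A x = 1) (i j : Idx k) :
    ⟪column A i x, column A j x⟫_ℝ = if i = j then 1 else 0 := by
  have := congrFun (congrFun hA i) j
  simp only [Matrix.mul_apply, Matrix.transpose_apply, Matrix.one_apply] at this
  rw [← this]
  simp [column, PiLp.inner_apply, mul_comm]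

theorem orthonormal_column {k : ℕ} {A : Plane → Matrix (Idx k) (Idx k) ℝ} {x : Plane}
    (hA : (A x)ᵀ * A x = 1) : Orthonormal ℝ fun j => column A j x :=
  orthonormal_iff_ite.2 (inner_column hA)

theorem sum_inner_column {k : ℕ} {A : Plane → Matrix (Idx k) (Idx k) ℝ} {x : Plane}
    (hA : (A x)ᵀ * A x = 1) (v : Amb k) : ∑ j, ⟪column A j x, v⟫_ℝ • column A j x = v := by
  have ho := orthonormal_column hA
  have hs := ho.linearIndependent.span_eq_top_of_card_eq_finrank (by simp)
  have := (OrthonormalBasis.mk ho hs.ge).sum_repr' v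
  simpa using this

/-- In terms of `ξ = (F, G)` the four blocks merge into `Dᵢ ξᵗ - ξ Dᵢᵗ`, the upper left block of
`lax`. Tangent and normal indices can then be treated together. -/
theorem omega_eq {k : ℕ} (F : Matrix (Fin 2) (Fin 2) ℝ) (G : Matrix (Fin k) (Fin 2) ℝ) (i : Fin 2)
    (a b : Idx k) : omega F G i a b =
      (if a = Sum.inl i then Matrix.fromRows F G b i else 0)
        - if b = Sum.inl i then Matrix.fromRows F G a i else 0 := by
  rcases a with a | a <;> rcases b with b | b <;> fin_cases i <;>
    simp [omega, C, Matrix.mul_apply, Matrix.single_apply, eq_comm, neg_add_eq_sub]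

/-- Columnwise form of `dA = A ω`. A vector `eⱼ` with `j ≠ i` moves only along `eᵢ`; for normal `eⱼ`
this yields both the parallel normal frame and the diagonal second fundamental form. -/
theorem hasPd_column {k : ℕ} {O : Set Plane} (hO : IsOpen O)
    {F : Plane → Matrix (Fin 2) (Fin 2) ℝ} {G : Plane → Matrix (Fin k) (Fin 2) ℝ}
    {A : Plane → Matrix (Idx k) (Idx k) ℝ} (hA : SmoothMatOn A O)
    (dA : ∀ x ∈ O, ∀ i, pdMat i A x = A x * omega (F x) (G x) i) {x : Plane} (hx : x ∈ O)
    (i : Fin 2) (j : Idx k) :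
    HasPd i (column A j)
      (Matrix.fromRows (F x) (G x) j i • column A (Sum.inl i) x
        - if j = Sum.inl i then ∑ a, Matrix.fromRows (F x) (G x) a i • column A a x else 0) x := by
  refine (hasPd_toLp fun a => hasPd_of_contDiffOn (hA a j) hO hx).congr_deriv ?_
  ext a
  have := congrFun (congrFun (dA x hx i) a) j
  simp only [pdMat, Matrix.of_apply] at this
  rw [PiLp.toLp_apply, this, Matrix.mul_apply]
  simp only [omega_eq, mul_sub, Finset.sum_sub_distrib]
  split_ifs with h
  · subst h
    simp [column, mul_comm]
  · simp [column, mul_comm]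

/-- `Y` is a surface over `O` with orthonormal frame `A` whose first two columns are tangent to the
coordinate lines, `∂Y/∂xᵢ = cᵢ eᵢ`, and such that `A⁻¹ dA` is the connection form of `(F, G)`. -/
structure IsAdapted {k : ℕ} (O : Set Plane) (Y : Plane → Amb k) (c : Fin 2 → Plane → ℝ)
    (F : Plane → Matrix (Fin 2) (Fin 2) ℝ) (G : Plane → Matrix (Fin k) (Fin 2) ℝ)
    (A : Plane → Matrix (Idx k) (Idx k) ℝ) : Prop where
  isOpen : IsOpen O
  smooth : ContDiffOn ℝ ∞ Y O
  smooth_c : ∀ i, ContDiffOn ℝ ∞ (c i) O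
  c_ne_zero : ∀ x ∈ O, ∀ i, c i x ≠ 0
  smooth_A : SmoothMatOn A O
  orthogonal : ∀ x ∈ O, (A x)ᵀ * A x = 1
  dA : ∀ x ∈ O, ∀ i, pdMat i A x = A x * omega (F x) (G x) i
  dY : ∀ x ∈ O, ∀ i, pd i Y x = c i x • column A (Sum.inl i) x

namespace IsAdapted

variable {k : ℕ} {O : Set Plane} {Y : Plane → Amb k} {c : Fin 2 → Plane → ℝ}
    {F : Plane → Matrix (Fin 2) (Fin 2) ℝ} {G : Plane → Matrix (Fin k) (Fin 2) ℝ}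
    {A : Plane → Matrix (Idx k) (Idx k) ℝ} {x : Plane}

theorem mono (h : IsAdapted O Y c F G A) {U : Set Plane} (hU : IsOpen U) (hUO : U ⊆ O) :
    IsAdapted U Y c F G A where
  isOpen := hU
  smooth := h.smooth.mono hUO
  smooth_c i := (h.smooth_c i).mono hUO
  c_ne_zero x hx := h.c_ne_zero x (hUO hx)
  smooth_A a b := (h.smooth_A a b).mono hUO
  orthogonal x hx := h.orthogonal x (hUO hx)
  dA x hx := h.dA x (hUO hx)
  dY x hx := h.dY x (hUO hx)

theorem fderiv_apply (h : IsAdapted O Y c F G A) (hx : x ∈ O) (v : Plane) :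
    fderiv ℝ Y x v = ∑ i, (v i * c i x) • column A (Sum.inl i) x := by
  simp [fderiv_eq_sum_pd, h.dY x hx, mul_smul]

theorem inner_column (h : IsAdapted O Y c F G A) (hx : x ∈ O) (i j : Idx k) :
    ⟪column A i x, column A j x⟫_ℝ = if i = j then 1 else 0 :=
  Isothermic.inner_column (h.orthogonal x hx) i j

theorem norm_column (h : IsAdapted O Y c F G A) (hx : x ∈ O) (i : Idx k) :
    ‖column A i x‖ = 1 :=
  (orthonormal_column (h.orthogonal x hx)).1 i

theorem inner_column_inl_fderiv (h : IsAdapted O Y c F G A) (hx : x ∈ O) (v : Plane) (i : Fin 2) :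
    ⟪column A (Sum.inl i) x, fderiv ℝ Y x v⟫_ℝ = v i * c i x := by
  fin_cases i <;>
    simp [h.fderiv_apply hx, inner_add_right, inner_smul_right, h.inner_column hx,
      h.norm_column hx]

theorem isImmersionOn (h : IsAdapted O Y c F G A) : IsImmersionOn Y O := by
  refine ⟨h.smooth, fun x hx => ?_⟩
  refine (injective_iff_map_eq_zero _).2 fun v hv => ?_
  ext i
  have := h.inner_column_inl_fderiv hx v i
  rw [hv, inner_zero_right] at this
  simpa [h.c_ne_zero x hx i] using this.symm

theorem firstForm_eq (h : IsAdapted O Y c F G A) (hx : x ∈ O) (v w : Plane) :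
    firstForm Y x v w = ∑ i, c i x ^ 2 * (v i * w i) := by
  rw [firstForm, h.fderiv_apply hx v, sum_inner]
  refine Finset.sum_congr rfl fun i _ => ?_
  rw [inner_smul_left, h.inner_column_inl_fderiv hx]
  simp only [conj_trivial]
  ring

theorem mem_normalSpace (h : IsAdapted O Y c F G A) (hx : x ∈ O) (ν : Amb k) :
    ν ∈ normalSpace Y x ↔ ∀ i, ⟪column A (Sum.inl i) x, ν⟫_ℝ = 0 := by
  rw [normalSpace, Submodule.mem_orthogonal]
  constructor
  · intro H i
    have := H (fderiv ℝ Y x (coordVec i)) ⟨_, rfl⟩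
    rw [show fderiv ℝ Y x (coordVec i) = _ from h.dY x hx i, inner_smul_left] at this
    simpa [h.c_ne_zero x hx i] using this
  · rintro H _ ⟨v, rfl⟩
    change ⟪fderiv ℝ Y x v, ν⟫_ℝ = 0
    simp [h.fderiv_apply hx, inner_add_left, inner_smul_left, H]

theorem column_mem_normalSpace (h : IsAdapted O Y c F G A) (hx : x ∈ O) (a : Fin k) :
    column A (Sum.inr a) x ∈ normalSpace Y x :=
  (h.mem_normalSpace hx _).2 fun i => by simp [h.inner_column hx]

theorem eq_sum_of_mem_normalSpace (h : IsAdapted O Y c F G A) (hx : x ∈ O) {ν : Amb k}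
    (hν : ν ∈ normalSpace Y x) :
    ∑ a : Fin k, ⟪column A (Sum.inr a) x, ν⟫_ℝ • column A (Sum.inr a) x = ν := by
  conv_rhs => rw [← sum_inner_column (h.orthogonal x hx) ν]
  simp [Fintype.sum_sum_type, (h.mem_normalSpace hx ν).1 hν]

theorem starProjection_normalSpace (h : IsAdapted O Y c F G A) (hx : x ∈ O) (v : Amb k) :
    (normalSpace Y x).starProjection v =
      ∑ a : Fin k, ⟪column A (Sum.inr a) x, v⟫_ℝ • column A (Sum.inr a) x := by
  refine Submodule.eq_starProjection_of_mem_of_inner_eq_zero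
    (Submodule.sum_mem _ fun a _ => Submodule.smul_mem _ _ (h.column_mem_normalSpace hx a))
    fun ν hν => ?_
  have hv : v - ∑ a : Fin k, ⟪column A (Sum.inr a) x, v⟫_ℝ • column A (Sum.inr a) x
      = ∑ i : Fin 2, ⟪column A (Sum.inl i) x, v⟫_ℝ • column A (Sum.inl i) x := by
    rw [sub_eq_iff_eq_add, ← Fintype.sum_sum_type
      (f := fun j => ⟪column A j x, v⟫_ℝ • column A j x), sum_inner_column (h.orthogonal x hx)]
  rw [hv, sum_inner]
  simp [inner_smul_left, (h.mem_normalSpace hx ν).1 hν]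

theorem hasPd_column (h : IsAdapted O Y c F G A) (hx : x ∈ O) (i : Fin 2) (j : Idx k) :
    HasPd i (column A j)
      (Matrix.fromRows (F x) (G x) j i • column A (Sum.inl i) x
        - if j = Sum.inl i then ∑ a, Matrix.fromRows (F x) (G x) a i • column A a x else 0) x :=
  Isothermic.hasPd_column h.isOpen h.smooth_A h.dA hx i j

theorem contDiffOn_column (h : IsAdapted O Y c F G A) (j : Idx k) :
    ContDiffOn ℝ ∞ (column A j) O :=
  contDiffOn_toLp fun a => h.smooth_A a j

theorem fderiv_column_inr (h : IsAdapted O Y c F G A) (hx : x ∈ O) (a : Fin k) (v : Plane) :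
    fderiv ℝ (column A (Sum.inr a)) x v = ∑ i, (v i * G x a i) • column A (Sum.inl i) x := by
  simp [fderiv_eq_sum_pd, (h.hasPd_column hx _ (Sum.inr a)).pd_eq, mul_smul]

theorem isParallelNormalFrame (h : IsAdapted O Y c F G A) :
    IsParallelNormalFrame Y O fun a => column A (Sum.inr a) := by
  refine ⟨fun a => ⟨h.contDiffOn_column _, fun x hx => ⟨h.column_mem_normalSpace hx a, fun v => ?_⟩⟩,
    fun x hx => (orthonormal_column (h.orthogonal x hx)).comp _ Sum.inr_injective⟩
  rw [h.starProjection_normalSpace hx, h.fderiv_column_inr hx]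
  simp [inner_add_right, inner_smul_right, h.inner_column hx]

theorem hasFlatNormalBundle (h : IsAdapted O Y c F G A) : HasFlatNormalBundle Y O :=
  fun _ hx => ⟨O, h.isOpen, hx, subset_rfl, _, h.isParallelNormalFrame⟩

/-- A normal component of `∂ⱼ(cᵢ eᵢ)` arises only for `j = i`, and equals `-cᵢ ∑ g_{ai} e_{2+a}`.
The sign convention in `secondForm` cancels the minus sign. -/
theorem secondForm_eq (h : IsAdapted O Y c F G A) (hx : x ∈ O) (v w : Plane) :
    secondForm Y x v w =
      ∑ a : Fin k, (∑ i, c i x * G x a i * (v i * w i)) • column A (Sum.inr a) x := by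
  have h1 : ∀ j, HasPd j (fun y => fderiv ℝ Y y w)
      (∑ i, ((w i * pd j (c i) x) • column A (Sum.inl i) x + (w i * c i x) •
        (Matrix.fromRows (F x) (G x) (Sum.inl i) j • column A (Sum.inl j) x
        - if Sum.inl i = (Sum.inl j : Idx k) then
          ∑ a, Matrix.fromRows (F x) (G x) a j • column A a x else 0))) x := fun j => by
    refine HasPd.congr_on (HasPd.sum fun i _ => HasPd.smul ?_ (h.hasPd_column hx j _)) h.isOpen hx
      fun y hy => h.fderiv_apply hy w
    exact ((hasPd_const (w i)).mul (hasPd_of_contDiffOn (h.smooth_c i) h.isOpen hx)).congr_deriv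
      (by simp)
  have h2 : fderiv ℝ (fderiv ℝ Y) x v w = fderiv ℝ (fun y => fderiv ℝ Y y w) x v := by
    have hd : DifferentiableAt ℝ (fderiv ℝ Y) x :=
      ((h.smooth.fderiv_of_isOpen h.isOpen (m := ∞) (by simp)).contDiffAt
        (h.isOpen.mem_nhds hx)).differentiableAt (by simp)
    rw [fderiv_clm_apply hd (differentiableAt_const w)]
    simp
  rw [secondForm, h.starProjection_normalSpace hx, h2, fderiv_eq_sum_pd, ← Finset.sum_neg_distrib]
  refine Finset.sum_congr rfl fun a _ => ?_
  rw [← neg_smul]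
  congr 1
  simp only [(h1 _).pd_eq]
  simp [inner_add_right, inner_sub_right, inner_smul_right, h.inner_column hx, inner_sum]
  ring

/-- The factors `cᵢ` may differ in sign from the common conformal factor `r`; the coefficients `p`
absorb these signs. -/
theorem hasForms (h : IsAdapted O Y c F G A) {r : Plane → ℝ} {p : Plane → Matrix (Fin k) (Fin 2) ℝ}
    (hc : ∀ x ∈ O, ∀ i, c i x ^ 2 = r x ^ 2) (hp : ∀ x ∈ O, ∀ a i, c i x * G x a i = r x * p x a i) :
    HasForms Y O r p fun a => column A (Sum.inr a) := by
  refine fun x hx v w => ⟨?_, ?_⟩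
  · rw [h.firstForm_eq hx]
    simp only [hc x hx, Fin.sum_univ_two]
    ring
  · rw [h.secondForm_eq hx, Finset.smul_sum]
    refine Finset.sum_congr rfl fun a _ => ?_
    rw [smul_smul]
    simp only [hp x hx, Fin.sum_univ_two]
    congr 1
    ring

theorem inner_secondForm (h : IsAdapted O Y c F G A) (hx : x ∈ O) (v w : Plane) (ν : Amb k) :
    ⟪secondForm Y x v w, ν⟫_ℝ =
      ∑ i, c i x * (∑ a : Fin k, G x a i * ⟪column A (Sum.inr a) x, ν⟫_ℝ) * (v i * w i) := by
  rw [h.secondForm_eq hx, sum_inner]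
  simp only [inner_smul_left, conj_trivial, Finset.mul_sum, Finset.sum_mul]
  rw [Finset.sum_comm]
  refine Finset.sum_congr rfl fun i _ => Finset.sum_congr rfl fun a _ => ?_
  ring

/-- Both fundamental forms are diagonal in the coordinates, so the principal curvature is the
quotient `cᵢ ∑ g_{ai} νₐ / cᵢ²`. -/
theorem isShapeEigen_smul_coordVec (h : IsAdapted O Y c F G A) (hx : x ∈ O) (ν : Amb k) (i : Fin 2)
    (r : ℝ) : IsShapeEigen Y x ν (r • coordVec i) := by
  have hc := h.c_ne_zero x hx
  refine ⟨(∑ a : Fin k, G x a i * ⟪column A (Sum.inr a) x, ν⟫_ℝ) / c i x, fun w => ?_⟩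
  rw [h.inner_secondForm hx, h.firstForm_eq hx, Finset.mul_sum]
  refine Finset.sum_congr rfl fun j _ => ?_
  by_cases hj : j = i
  · subst hj
    field_simp [hc j]
  · simp [coordVec, hj]

theorem isCurvatureLineCoords (h : IsAdapted O Y c F G A) : IsCurvatureLineCoords Y O := by
  refine fun x hx => ⟨by simp [h.firstForm_eq hx, coordVec], fun ν _ i => ?_⟩
  simpa using h.isShapeEigen_smul_coordVec hx ν i 1

/-- Principal directions are coordinate directions. -/
theorem exists_eq_smul_coordVec (h : IsAdapted O Y c F G A) (hx : x ∈ O) {ν : Amb k} {v : Plane}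
    (hv : IsPrincipalDirection Y x ν v) : ∃ (i : Fin 2) (r : ℝ), r ≠ 0 ∧ v = r • coordVec i := by
  obtain ⟨hv0, ⟨κ, hκ⟩, hall⟩ := hv
  suffices ∃ (i : Fin 2) (r : ℝ), v = r • coordVec i by
    obtain ⟨i, r, rfl⟩ := this
    exact ⟨i, r, fun hr => hv0 (by simp [hr]), rfl⟩
  by_cases h0 : v 0 = 0
  · exact ⟨1, v 1, by ext j; fin_cases j <;> simp [coordVec, h0]⟩
  by_cases h1 : v 1 = 0
  · exact ⟨0, v 0, by ext j; fin_cases j <;> simp [coordVec, h1]⟩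
  refine hall fun w => ⟨κ, fun w' => ?_⟩
  -- With both components of `v` nonzero, testing the eigenvalue equation on each coordinate vector
  -- shows that both principal curvatures equal `κ`. Thus `A_ν` is a multiple of the identity, and
  -- the convention for that case applies.
  have key : ∀ i, c i x * (∑ a : Fin k, G x a i * ⟪column A (Sum.inr a) x, ν⟫_ℝ)
      = κ * c i x ^ 2 := fun i => by
    have := hκ (coordVec i)
    rw [h.inner_secondForm hx, h.firstForm_eq hx] at this
    have hvi : v i ≠ 0 := by fin_cases i <;> assumption
    fin_cases i <;> simp [coordVec] at this hvi ⊢ <;>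
      exact mul_right_cancel₀ hvi (by linarith)
  rw [h.inner_secondForm hx, h.firstForm_eq hx, Finset.mul_sum]
  refine Finset.sum_congr rfl fun i _ => ?_
  rw [key]
  ring

theorem isIsothermic (h : IsAdapted O Y c F G A) {u : Plane → ℝ} (hu : ContDiffOn ℝ ∞ u O)
    {σ : Fin 2 → ℝ} (hσ : ∀ i, σ i ^ 2 = 1) (hG : SmoothMatOn G O)
    (hc : ∀ x ∈ O, ∀ i, c i x = σ i * Real.exp (u x)) : IsIsothermic O Y := by
  refine ⟨h.isImmersionOn, u, fun x => Matrix.of fun a i => σ i * G x a i,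
    fun a => column A (Sum.inr a), hu, fun a i => ?_, h.isParallelNormalFrame,
    h.hasForms (fun x hx i => ?_) fun x hx a i => ?_⟩
  · exact contDiffOn_const.mul (hG a i)
  · rw [hc x hx, mul_pow, hσ, one_mul]
  · rw [hc x hx, Matrix.of_apply]
    ring

end IsAdapted

/-! ### Ribaucour transformations by reflections of the adapted frame -/

/-- The lines through `p` and `p + ρη` in directions exchanged by the reflection in `η^⊥` meet
equidistantly. -/
theorem linesMeetEquidistantly_reflection {k : ℕ} (p d η : Amb k) (ρ : ℝ) (hη : ‖η‖ = 1) {r : ℝ}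
    (hr : r ≠ 0) :
    LinesMeetEquidistantly p d (p + ρ • η) (r • (d - (2 * ⟪η, d⟫_ℝ) • η)) := by
  set h := ⟪η, d⟫_ℝ with hh
  have hηη : ⟪η, η⟫_ℝ = 1 := by rw [real_inner_self_eq_norm_sq, hη, one_pow]
  -- A direction orthogonal to `η` is fixed by the reflection: the lines are parallel and meet at
  -- infinity.
  by_cases h0 : h = 0
  · refine Or.inr ⟨⟨r, hr, by simp [h0]⟩, ?_⟩
    rw [add_sub_cancel_left, inner_smul_left, ← hh, h0, mul_zero]
  -- The parameter solves `t d = ρ η + t (d - 2hη)`, that is `2ht = ρ`. The reflection is an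
  -- isometry, so both legs have length `|t| ‖d‖`; the scale `r` only changes the second parameter.
  · have e : p + (ρ / (2 * h)) • d
        = p + ρ • η + (ρ / (2 * h) / r) • r • (d - (2 * h) • η) := by
      rw [smul_smul, div_mul_cancel₀ _ hr, smul_sub, smul_smul,
        div_mul_cancel₀ _ (mul_ne_zero two_ne_zero h0)]
      abel
    refine Or.inl ⟨ρ / (2 * h), ρ / (2 * h) / r, e, ?_⟩
    have hn : ‖d - (2 * h) • η‖ = ‖d‖ := by
      rw [← sq_eq_sq₀ (norm_nonneg _) (norm_nonneg _), ← real_inner_self_eq_norm_sq,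
        ← real_inner_self_eq_norm_sq, inner_sub_left, inner_sub_right, inner_sub_right,
        inner_smul_left, inner_smul_right, inner_smul_right, inner_smul_left,
        real_inner_comm η d, ← hh, hηη]
      simp only [conj_trivial]
      ring
    conv_rhs => rw [e]
    rw [dist_eq_norm, dist_eq_norm, add_sub_cancel_left, add_sub_cancel_left, smul_smul,
      div_mul_cancel₀ _ hr, norm_smul, norm_smul, hn]

/-- `Y'` is obtained from the adapted surface `Y` by moving along the unit field `η` and reflecting
the adapted frame in `η^⊥`. -/
structure IsReflectionPair {k : ℕ} (O : Set Plane) (Y Y' : Plane → Amb k)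
    (A A' : Plane → Matrix (Idx k) (Idx k) ℝ) (η : Plane → Amb k) (ρ : Plane → ℝ) : Prop where
  norm_eq_one : ∀ x ∈ O, ‖η x‖ = 1
  eq_add : ∀ x ∈ O, Y' x = Y x + ρ x • η x
  column_eq : ∀ x ∈ O, ∀ j, column A' j x = column A j x - (2 * ⟪η x, column A j x⟫_ℝ) • η x

theorem bundleMap_apply {k : ℕ} (e f : Fin k → Plane → Amb k) (x : Plane) (ν : Amb k) :
    bundleMap e f x ν = ∑ a, ⟪e a x, ν⟫_ℝ • f a x := by
  simp [bundleMap]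

namespace IsReflectionPair

variable {k : ℕ} {O : Set Plane} {Y Y' : Plane → Amb k} {c c' : Fin 2 → Plane → ℝ}
    {F F' : Plane → Matrix (Fin 2) (Fin 2) ℝ} {G G' : Plane → Matrix (Fin k) (Fin 2) ℝ}
    {A A' : Plane → Matrix (Idx k) (Idx k) ℝ} {η : Plane → Amb k} {ρ : Plane → ℝ} {x : Plane}

local notation "P" => bundleMap (fun a : Fin k => column A (Sum.inr a))
  (fun a : Fin k => column A' (Sum.inr a))

theorem inner_column_bundleMap (h' : IsAdapted O Y' c' F' G' A') (hx : x ∈ O) (ν : Amb k)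
    (a : Fin k) : ⟪column A' (Sum.inr a) x, P x ν⟫_ℝ = ⟪column A (Sum.inr a) x, ν⟫_ℝ := by
  rw [bundleMap_apply]
  simp [inner_sum, inner_smul_right, h'.inner_column hx]

theorem bundleMap_mem (h' : IsAdapted O Y' c' F' G' A') (hx : x ∈ O) (ν : Amb k) :
    P x ν ∈ normalSpace Y' x := by
  rw [bundleMap_apply]
  exact Submodule.sum_mem _ fun a _ => Submodule.smul_mem _ _ (h'.column_mem_normalSpace hx a)

theorem bijOn_bundleMap (h : IsAdapted O Y c F G A) (h' : IsAdapted O Y' c' F' G' A')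
    (hx : x ∈ O) : Set.BijOn (P x) (normalSpace Y x) (normalSpace Y' x) := by
  refine ⟨fun ν _ => bundleMap_mem h' hx ν, fun ν hν μ hμ hνμ => ?_, fun μ hμ => ?_⟩
  · rw [← h.eq_sum_of_mem_normalSpace hx hν, ← h.eq_sum_of_mem_normalSpace hx hμ]
    refine Finset.sum_congr rfl fun a _ => ?_
    rw [← inner_column_bundleMap h' hx ν, hνμ, inner_column_bundleMap h' hx]
  · refine ⟨∑ a : Fin k, ⟪column A' (Sum.inr a) x, μ⟫_ℝ • column A (Sum.inr a) x,
      Submodule.sum_mem _ fun a _ => Submodule.smul_mem _ _ (h.column_mem_normalSpace hx a), ?_⟩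
    rw [bundleMap_apply]
    conv_rhs => rw [← h'.eq_sum_of_mem_normalSpace hx hμ]
    simp [inner_sum, inner_smul_right, h.inner_column hx]

theorem isParallelNormal_bundleMap (h : IsAdapted O Y c F G A)
    (h' : IsAdapted O Y' c' F' G' A') {ν : Plane → Amb k} (hν : IsParallelNormal Y O ν) :
    IsParallelNormal Y' O fun x => P x (ν x) := by
  -- The coefficients of a parallel normal field in the parallel frame have zero derivative, and `P`
  -- keeps these coefficients.
  have hpd : ∀ x ∈ O, ∀ i (a : Fin k),
      HasPd i (fun y => ⟪column A (Sum.inr a) y, ν y⟫_ℝ) 0 x := fun x hx i a => by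
    refine ((h.hasPd_column hx i (Sum.inr a)).inner
      (hasPd_of_contDiffOn hν.1 h.isOpen hx)).congr_deriv ?_
    have h1 := (hν.2 x hx).2 (coordVec i)
    rw [h.starProjection_normalSpace hx] at h1
    have h2 := congrArg (fun v => ⟪column A (Sum.inr a) x, v⟫_ℝ) h1
    simp only [inner_sum, inner_smul_right, h.inner_column hx, Sum.inr.injEq, mul_ite, mul_one,
      mul_zero, Finset.sum_ite_eq, Finset.mem_univ, if_true, inner_zero_right] at h2
    rw [show ⟪column A (Sum.inr a) x, pd i ν x⟫_ℝ = 0 from h2]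
    simp [inner_smul_left, (h.mem_normalSpace hx _).1 (hν.2 x hx).1]
  refine ⟨?_, fun x hx => ⟨bundleMap_mem h' hx _, fun v => ?_⟩⟩
  · simp only [bundleMap_apply]
    exact ContDiffOn.sum fun a _ => ((h.contDiffOn_column _).inner ℝ hν.1).smul
      (h'.contDiffOn_column _)
  · have h1 : ∀ i, pd i (fun y => P y (ν y)) x =
        ∑ a : Fin k, ⟪column A (Sum.inr a) x, ν x⟫_ℝ • G' x a i • column A' (Sum.inl i) x := by
      intro i
      simp only [bundleMap_apply]
      rw [(HasPd.sum fun a _ => (hpd x hx i a).smul (h'.hasPd_column hx i (Sum.inr a))).pd_eq]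
      simp
    rw [fderiv_eq_sum_pd, map_sum]
    refine Finset.sum_eq_zero fun i _ => ?_
    rw [map_smul, h1, h'.starProjection_normalSpace hx]
    simp [inner_sum, inner_smul_right, h'.inner_column hx]

/-- `P` agrees with the reflection in `η^⊥` on the normal frame vectors, hence by linearity on the
whole normal space. -/
theorem bundleMap_eq (H : IsReflectionPair O Y Y' A A' η ρ) (h : IsAdapted O Y c F G A)
    (hx : x ∈ O) {ν : Amb k} (hν : ν ∈ normalSpace Y x) :
    P x ν = ν - (2 * ⟪η x, ν⟫_ℝ) • η x := by
  rw [bundleMap_apply]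
  simp only [H.column_eq x hx, smul_sub, Finset.sum_sub_distrib, smul_smul, ← Finset.sum_smul]
  rw [h.eq_sum_of_mem_normalSpace hx hν]
  congr 2
  conv_rhs => rw [← h.eq_sum_of_mem_normalSpace hx hν, inner_sum, Finset.mul_sum]
  refine Finset.sum_congr rfl fun a _ => ?_
  rw [inner_smul_right]
  ring

/-- `∂ᵢY'` is `c'ᵢ / cᵢ` times the reflection of `∂ᵢY`, so the reflection lemma applies with this
scale. -/
theorem linesMeetEquidistantly_fderiv (H : IsReflectionPair O Y Y' A A' η ρ)
    (h : IsAdapted O Y c F G A) (h' : IsAdapted O Y' c' F' G' A') (hx : x ∈ O) (i : Fin 2) (r : ℝ) :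
    LinesMeetEquidistantly (Y x) (fderiv ℝ Y x (r • coordVec i)) (Y' x)
      (fderiv ℝ Y' x (r • coordVec i)) := by
  have hc := h.c_ne_zero x hx i
  have hc' := h'.c_ne_zero x hx i
  have e1 : fderiv ℝ Y x (r • coordVec i) = r • c i x • column A (Sum.inl i) x := by
    rw [map_smul, ← h.dY x hx i, pd]
  have e2 : fderiv ℝ Y' x (r • coordVec i) = (c' i x / c i x) •
      (r • c i x • column A (Sum.inl i) x -
        (2 * ⟪η x, r • c i x • column A (Sum.inl i) x⟫_ℝ) • η x) := by
    have : fderiv ℝ Y' x (coordVec i) = _ := h'.dY x hx i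
    rw [map_smul, this, H.column_eq x hx, inner_smul_right, inner_smul_right]
    simp only [smul_sub, smul_smul]
    congr 2 <;> field_simp
  rw [e1, e2, H.eq_add x hx]
  exact linesMeetEquidistantly_reflection _ _ _ _ (H.norm_eq_one x hx) (div_ne_zero hc' hc)

theorem isRibaucour (H : IsReflectionPair O Y Y' A A' η ρ) (h : IsAdapted O Y c F G A)
    (h' : IsAdapted O Y' c' F' G' A') : IsRibaucour O Y Y' P where
  immersion := h.isImmersionOn
  immersion_new := h'.isImmersionOn
  flat := h.hasFlatNormalBundle
  flat_new := h'.hasFlatNormalBundle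
  coords := h.isCurvatureLineCoords
  coords_new := h'.isCurvatureLineCoords
  smooth := by
    unfold bundleMap
    exact ContDiffOn.sum fun a _ =>
      ((innerSL ℝ).contDiff.comp_contDiffOn (h.contDiffOn_column _)).smulRight
        (h'.contDiffOn_column _)
  bundle_iso x hx := bijOn_bundleMap h h' hx
  parallel U hU hUO ν hν := isParallelNormal_bundleMap (h.mono hU hUO) (h'.mono hU hUO) hν
  normal_lines x hx ν hν _ := by
    rw [H.bundleMap_eq h hx hν, H.eq_add x hx]
    simpa using linesMeetEquidistantly_reflection (Y x) ν (η x) (ρ x) (H.norm_eq_one x hx)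
      one_ne_zero
  principal x hx ν _ v hv := by
    obtain ⟨i, r, _, rfl⟩ := h.exists_eq_smul_coordVec hx hv
    exact h'.isShapeEigen_smul_coordVec hx _ i r
  tangent_lines x hx ν _ v hv := by
    obtain ⟨i, r, _, rfl⟩ := h.exists_eq_smul_coordVec hx hv
    exact H.linesMeetEquidistantly_fderiv h h' hx i r

theorem isDarboux (H : IsReflectionPair O Y Y' A A' η ρ) (h : IsAdapted O Y c F G A)
    (h' : IsAdapted O Y' c' F' G' A') (hc : ∀ x ∈ O, c 1 x ^ 2 = c 0 x ^ 2)
    (hc' : ∀ x ∈ O, c' 1 x ^ 2 = c' 0 x ^ 2) : IsDarboux O Y Y' P := by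
  refine ⟨H.isRibaucour h h', fun x hx => ⟨c' 0 x ^ 2 / c 0 x ^ 2, ?_, fun v w => ?_⟩⟩
  · have := h.c_ne_zero x hx 0
    have := h'.c_ne_zero x hx 0
    positivity
  · rw [h.firstForm_eq hx, h'.firstForm_eq hx, Fin.sum_univ_two, Fin.sum_univ_two, hc x hx,
      hc' x hx]
    have := h.c_ne_zero x hx 0
    field_simp

end IsReflectionPair

/-! ### The normalized dressing equations -/

/-- The diagonal entries of `J = diag(1, -1)`. -/
def lorentzSign : Fin 2 → ℝ := ![1, -1]

@[simp] theorem lorentzSign_zero : lorentzSign 0 = 1 := rfl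

@[simp] theorem lorentzSign_one : lorentzSign 1 = -1 := rfl

/-- `(w, z)` are unit vectors of `ℝᵐ` and `ℝ^{1,1}` spanning a projectively parallel line
`ℂ (w, i z)` of the Lax connection of `(F, G)` at `λ = -is`. -/
structure IsDressing {k : ℕ} (O : Set Plane) (F : Plane → Matrix (Fin 2) (Fin 2) ℝ)
    (G : Plane → Matrix (Fin k) (Fin 2) ℝ) (s : ℝ) (w : Plane → Amb k)
    (z : Plane → Fin 2 → ℝ) : Prop where
  isOpen : IsOpen O
  smooth_w : ContDiffOn ℝ ∞ w O
  smooth_z : ∀ j, ContDiffOn ℝ ∞ (fun y => z y j) O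
  norm_w : ∀ x ∈ O, ‖w x‖ = 1
  norm_z : ∀ x ∈ O, z x 0 ^ 2 - z x 1 ^ 2 = 1
  dw : ∀ x ∈ O, ∀ i a, HasPd i (fun y => w y a)
    ((if a = Sum.inl i then
        s * lorentzSign i * z x i - ∑ b, Matrix.fromRows (F x) (G x) b i * w x b else 0)
      + Matrix.fromRows (F x) (G x) a i * w x (Sum.inl i)
      - s * lorentzSign i * z x i * w x (Sum.inl i) * w x a) x
  dz : ∀ x ∈ O, ∀ i j, HasPd i (fun y => z y j)
    ((if j = i then s * w x (Sum.inl i) - ∑ l, F x i l * z x l else 0)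
      + lorentzSign j * lorentzSign i * F x i j * z x i
      - s * lorentzSign i * z x i * w x (Sum.inl i) * z x j) x

namespace IsDressing

variable {k : ℕ} {O : Set Plane} {F F' : Plane → Matrix (Fin 2) (Fin 2) ℝ}
  {G G' : Plane → Matrix (Fin k) (Fin 2) ℝ} {s : ℝ} {w : Plane → Amb k} {z : Plane → Fin 2 → ℝ}
  {A A' : Plane → Matrix (Idx k) (Idx k) ℝ} {Y : Plane → Amb k} {c : Fin 2 → Plane → ℝ} {x : Plane}

theorem sum_sq (h : IsDressing O F G s w z) (hx : x ∈ O) : ∑ a, w x a ^ 2 = 1 := by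
  rw [← EuclideanSpace.real_norm_sq_eq, h.norm_w x hx, one_pow]

/-- The direction `∑ wᵢ eᵢ` of the transformation. -/
def direction (A : Plane → Matrix (Idx k) (Idx k) ℝ) (w : Plane → Amb k) (x : Plane) : Amb k :=
  ∑ j, w x j • column A j x

theorem inner_direction (hA : (A x)ᵀ * A x = 1) (w : Plane → Amb k) (j : Idx k) :
    ⟪direction A w x, column A j x⟫_ℝ = w x j := by
  simp only [direction, sum_inner, inner_smul_left, inner_column hA, conj_trivial, mul_ite, mul_one,
    mul_zero, Finset.sum_ite_eq', Finset.mem_univ, if_true]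

theorem inner_direction_self (h : IsDressing O F G s w z) (hA : (A x)ᵀ * A x = 1) (hx : x ∈ O) :
    ⟪direction A w x, direction A w x⟫_ℝ = 1 := by
  change ⟪∑ j, w x j • column A j x, direction A w x⟫_ℝ = 1
  rw [sum_inner, ← h.sum_sq hx]
  refine Finset.sum_congr rfl fun j _ => ?_
  rw [inner_smul_left, real_inner_comm, inner_direction hA, conj_trivial, sq]

theorem norm_direction (h : IsDressing O F G s w z) (hA : (A x)ᵀ * A x = 1) (hx : x ∈ O) :
    ‖direction A w x‖ = 1 := by
  have := h.inner_direction_self hA hx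
  rw [real_inner_self_eq_norm_sq] at this
  exact (pow_eq_one_iff_of_nonneg (norm_nonneg _) two_ne_zero).1 this

theorem contDiffOn_direction (h : IsDressing O F G s w z) (hA : SmoothMatOn A O) :
    ContDiffOn ℝ ∞ (direction A w) O :=
  ContDiffOn.sum fun j _ =>
    (contDiffOn_euclidean.1 h.smooth_w j).smul (contDiffOn_toLp fun a => hA a j)

/-- The terms with `F` and `G` in `∂ᵢw` and in `∂ᵢeⱼ` cancel because the connection form is skew.
Only the part from `λ = -is` and from the normalization survives. -/
theorem hasPd_direction (h : IsDressing O F G s w z) (hA : SmoothMatOn A O)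
    (dA : ∀ x ∈ O, ∀ i, pdMat i A x = A x * omega (F x) (G x) i) (hx : x ∈ O) (i : Fin 2) :
    HasPd i (direction A w) ((s * lorentzSign i * z x i) •
      (column A (Sum.inl i) x - w x (Sum.inl i) • direction A w x)) x := by
  refine (HasPd.sum fun j _ => (h.dw x hx i j).smul
    (hasPd_column h.isOpen hA dA hx i j)).congr_deriv ?_
  simp only [add_smul, sub_smul, smul_sub, Finset.sum_add_distrib, Finset.sum_sub_distrib, ite_smul,
    zero_smul, smul_ite, smul_zero, Finset.sum_ite_eq', Finset.mem_univ, if_true, direction,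
    Finset.smul_sum, smul_smul, Finset.sum_smul]
  have e1 : ∀ a, (w x (Sum.inl i) * Matrix.fromRows (F x) (G x) a i)
      = (Matrix.fromRows (F x) (G x) a i * w x (Sum.inl i)) := fun a => mul_comm _ _
  have e2 : ∀ a, (w x a * Matrix.fromRows (F x) (G x) a i)
      = (Matrix.fromRows (F x) (G x) a i * w x a) := fun a => mul_comm _ _
  simp only [e1, e2, mul_assoc]
  abel

/-- The reflection of an orthonormal frame `A` in `(∑ wᵢ eᵢ)^⊥` is orthonormal. -/
theorem orthogonal_reflected (h : IsDressing O F G s w z) (hA : (A x)ᵀ * A x = 1) (hx : x ∈ O)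
    (hA' : ∀ j, column A' j x = column A j x - (2 * w x j) • direction A w x) :
    (A' x)ᵀ * A' x = 1 := by
  ext i j
  have e : ((A' x)ᵀ * A' x) i j = ⟪column A' i x, column A' j x⟫_ℝ := by
    simp [Matrix.mul_apply, column, PiLp.inner_apply, mul_comm]
  rw [e, hA', hA', inner_sub_left, inner_sub_right, inner_sub_right, inner_smul_left,
    inner_smul_right, inner_smul_right, inner_smul_left, inner_direction hA,
    real_inner_comm (direction A w x) (column A i x), inner_direction hA, inner_column hA, h.inner_direction_self hA hx,
    Matrix.one_apply]
  simp only [conj_trivial, eq_comm]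
  ring

theorem smooth_reflected (h : IsDressing O F G s w z) (hA : SmoothMatOn A O)
    (hA' : ∀ x ∈ O, ∀ j, column A' j x = column A j x - (2 * w x j) • direction A w x) :
    SmoothMatOn A' O := by
  intro a j
  have h1 : ContDiffOn ℝ ∞ (fun x => column A j x - (2 * w x j) • direction A w x) O :=
    (contDiffOn_toLp fun a => hA a j).sub
      ((contDiffOn_const.mul (contDiffOn_euclidean.1 h.smooth_w j)).smul
        (h.contDiffOn_direction hA))
  exact (contDiffOn_euclidean.1 h1 a).congr fun x hx => congrArg (fun v : Amb k => v a) (hA' x hx j)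

theorem pdMat_of_hasPd_column {i : Fin 2} {F : Matrix (Fin 2) (Fin 2) ℝ}
    {G : Matrix (Fin k) (Fin 2) ℝ}
    (h : ∀ j, HasPd i (column A j) (Matrix.fromRows F G j i • column A (Sum.inl i) x
        - if j = Sum.inl i then ∑ a, Matrix.fromRows F G a i • column A a x else 0) x) :
    pdMat i A x = A x * omega F G i := by
  ext a j
  rw [pdMat, Matrix.of_apply, show (fun y => A y a j) = fun y => column A j y a from rfl,
    ((h j).apply a).pd_eq, Matrix.mul_apply]
  simp only [omega_eq, mul_sub, Finset.sum_sub_distrib]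
  split_ifs with hj
  · subst hj
    simp [column, mul_comm]
  · simp [column, mul_comm]

/-- For `j ≠ i`, differentiating `eⱼ - 2wⱼη` gives `(ξ_{ji} - 2s Jᵢ zᵢ wⱼ)(eᵢ - 2wᵢη)`, from which
the new coefficient is read off. The case `j = i` also uses `|w| = 1`. -/
theorem dA_reflected (h : IsDressing O F G s w z) (hA : SmoothMatOn A O)
    (dA : ∀ x ∈ O, ∀ i, pdMat i A x = A x * omega (F x) (G x) i)
    (hA' : ∀ x ∈ O, ∀ j, column A' j x = column A j x - (2 * w x j) • direction A w x)
    (hξ : ∀ x ∈ O, ∀ a i, a ≠ Sum.inl i → Matrix.fromRows (F' x) (G' x) a i =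
      Matrix.fromRows (F x) (G x) a i - 2 * s * lorentzSign i * z x i * w x a) (hx : x ∈ O)
    (i : Fin 2) : pdMat i A' x = A' x * omega (F' x) (G' x) i := by
  refine pdMat_of_hasPd_column fun j => ?_
  have h1 := (hasPd_column h.isOpen hA dA hx i j).sub
    (((hasPd_const (2 : ℝ)).mul (h.dw x hx i j)).smul (h.hasPd_direction hA dA hx i))
  refine (h1.congr_on h.isOpen hx fun y hy => hA' y hy j).congr_deriv ?_
  by_cases hj : j = Sum.inl i
  · subst hj
    -- The `(i, i)` entry of `ξ'` cancels from the connection form, and `hξ` does not prescribe it.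
    -- It may thus be replaced by the value given by the formula for the other entries, so that the
    -- sum becomes uniform.
    have e1 : ∀ r : ℝ, r • column A' (Sum.inl i) x
        - ∑ a, Matrix.fromRows (F' x) (G' x) a i • column A' a x =
      (r - Matrix.fromRows (F' x) (G' x) (Sum.inl i) i +
        (Matrix.fromRows (F x) (G x) (Sum.inl i) i
          - 2 * s * lorentzSign i * z x i * w x (Sum.inl i))) • column A' (Sum.inl i) x
        - ∑ a, (Matrix.fromRows (F x) (G x) a i - 2 * s * lorentzSign i * z x i * w x a)
            • column A' a x := fun r => by
      rw [← Finset.add_sum_erase _ _ (Finset.mem_univ (Sum.inl i)),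
        ← Finset.add_sum_erase (a := (Sum.inl i : Idx k)) _
          (fun a => (Matrix.fromRows (F x) (G x) a i - 2 * s * lorentzSign i * z x i * w x a)
            • column A' a x) (Finset.mem_univ (Sum.inl i)),
        Finset.sum_congr rfl fun a ha => by rw [hξ x hx a i (Finset.ne_of_mem_erase ha)]]
      module
    have e2 : ∑ a, (Matrix.fromRows (F x) (G x) a i - 2 * s * lorentzSign i * z x i * w x a)
            • column A' a x = ∑ a, Matrix.fromRows (F x) (G x) a i • column A a x
          - (2 * ∑ a, Matrix.fromRows (F x) (G x) a i * w x a) • direction A w x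
          + (2 * s * lorentzSign i * z x i) • direction A w x := by
      have e3 : ∑ a, w x a • (2 * w x a) • direction A w x = (2 : ℝ) • direction A w x := by
        simp only [smul_smul, ← Finset.sum_smul]
        rw [← mul_one (2 : ℝ), ← h.sum_sq hx, Finset.mul_sum]
        congr 1
        exact Finset.sum_congr rfl fun a _ => by ring
      -- The reflection sends `η` to `-η`.
      have e4 : ∑ a, w x a • column A' a x = -direction A w x := by
        simp only [hA' x hx, smul_sub, Finset.sum_sub_distrib, e3]
        rw [← direction]
        module
      have e5 : ∑ a, Matrix.fromRows (F x) (G x) a i • column A' a x =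
          ∑ a, Matrix.fromRows (F x) (G x) a i • column A a x
            - (2 * ∑ a, Matrix.fromRows (F x) (G x) a i * w x a) • direction A w x := by
        simp only [hA' x hx, smul_sub, Finset.sum_sub_distrib, Finset.mul_sum, Finset.sum_smul,
          smul_smul]
        congr 1
        exact Finset.sum_congr rfl fun a _ => by congr 1; ring
      simp only [sub_smul, Finset.sum_sub_distrib, mul_smul _ (w x _), ← Finset.smul_sum, e4, e5]
      module
    rw [if_pos rfl, if_pos rfl, if_pos rfl, e1, e2, hA' x hx]
    module
  · rw [if_neg hj, if_neg hj, if_neg hj, hξ x hx j i hj, hA' x hx]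
    module

theorem isReflectionPair (h : IsDressing O F G s w z) (hA : ∀ x ∈ O, (A x)ᵀ * A x = 1)
    (hA' : ∀ x ∈ O, ∀ j, column A' j x = column A j x - (2 * w x j) • direction A w x)
    {Y' : Plane → Amb k} {ρ : Plane → ℝ}
    (hY' : ∀ x ∈ O, Y' x = Y x + ρ x • direction A w x) :
    IsReflectionPair O Y Y' A A' (direction A w) ρ where
  norm_eq_one x hx := h.norm_direction (hA x hx) hx
  eq_add := hY'
  column_eq x hx j := by rw [hA' x hx, inner_direction (hA x hx)]

/-- The derivative of `Y + ρη` is `(cᵢ + sρ Jᵢ zᵢ) eᵢ + (∂ᵢρ - sρ Jᵢ zᵢ wᵢ) η`. The hypothesis on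
`∂ᵢρ` says that this is a multiple of the reflected vector `eᵢ - 2wᵢη`. -/
theorem isAdapted_reflected (h : IsDressing O F G s w z) (hY : IsAdapted O Y c F G A)
    (hA' : ∀ x ∈ O, ∀ j, column A' j x = column A j x - (2 * w x j) • direction A w x)
    (hξ : ∀ x ∈ O, ∀ a i, a ≠ Sum.inl i → Matrix.fromRows (F' x) (G' x) a i =
      Matrix.fromRows (F x) (G x) a i - 2 * s * lorentzSign i * z x i * w x a)
    {Y' : Plane → Amb k} {ρ : Plane → ℝ} (hρ : ContDiffOn ℝ ∞ ρ O)
    (dρ : ∀ x ∈ O, ∀ i, HasPd i ρ (-2 * c i x * w x (Sum.inl i)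
      - s * lorentzSign i * z x i * w x (Sum.inl i) * ρ x) x)
    (hY' : ∀ x ∈ O, Y' x = Y x + ρ x • direction A w x)
    {c' : Fin 2 → Plane → ℝ} (hc' : ∀ x ∈ O, ∀ i, c' i x = c i x + s * ρ x * lorentzSign i * z x i)
    (hc0 : ∀ x ∈ O, ∀ i, c' i x ≠ 0) : IsAdapted O Y' c' F' G' A' where
  isOpen := h.isOpen
  smooth := (hY.smooth.add (hρ.smul (h.contDiffOn_direction hY.smooth_A))).congr hY'
  smooth_c i := ((hY.smooth_c i).add (((contDiffOn_const.mul hρ).mul contDiffOn_const).mul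
    (h.smooth_z i))).congr fun x hx => hc' x hx i
  c_ne_zero := hc0
  smooth_A := h.smooth_reflected hY.smooth_A hA'
  orthogonal x hx := h.orthogonal_reflected (hY.orthogonal x hx) hx (hA' x hx)
  dA x hx i := h.dA_reflected hY.smooth_A hY.dA hA' hξ hx i
  dY x hx i := by
    have := ((hasPd_of_contDiffOn (i := i) hY.smooth h.isOpen hx).add
      ((dρ x hx i).smul (h.hasPd_direction hY.smooth_A hY.dA hx i))).congr_on h.isOpen hx hY'
    rw [this.pd_eq, hY.dY x hx, hA' x hx, hc' x hx]
    module

end IsDressing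

/-! ### Dressing of solutions of the Gauss-Codazzi-Ricci equations -/

namespace IsDressing

variable {k : ℕ} {O : Set Plane} {G G' : Plane → Matrix (Fin k) (Fin 2) ℝ} {s : ℝ}
  {w : Plane → Amb k} {z : Plane → Fin 2 → ℝ} {u u' : Plane → ℝ} {x : Plane}

theorem sub_ne_zero_of_mem {F : Plane → Matrix (Fin 2) (Fin 2) ℝ} (h : IsDressing O F G s w z)
    (hx : x ∈ O) : z x 0 - z x 1 ≠ 0 := by
  intro h0
  have := h.norm_z x hx
  rw [sq_sub_sq, h0, mul_zero] at this
  exact zero_ne_one this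

/-- `Real.log` is the logarithm of the absolute value, so one formula covers both signs of `z₁ -
z₂`. -/
theorem contDiffOn_newU {F : Plane → Matrix (Fin 2) (Fin 2) ℝ} (h : IsDressing O F G s w z)
    (hu : ContDiffOn ℝ ∞ u O) (hu' : ∀ x ∈ O, u' x = 2 * Real.log (z x 0 - z x 1) - u x) :
    ContDiffOn ℝ ∞ u' O :=
  ((contDiffOn_const.mul (((h.smooth_z 0).sub (h.smooth_z 1)).log
    fun _ hx => h.sub_ne_zero_of_mem hx)).sub hu).congr hu'

/-- By `1/(z₁ - z₂) = z₁ + z₂` the logarithmic derivative becomes polynomial. The results are the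
off-diagonal entries of `ξ - 2s (w zᵗ J)_*`, which identifies the new `F` with `offDiag u'`. -/
theorem hasPd_newU (h : IsDressing O (offDiag u) G s w z) (hu : ContDiffOn ℝ ∞ u O)
    (hu' : ∀ x ∈ O, u' x = 2 * Real.log (z x 0 - z x 1) - u x) (hx : x ∈ O) :
    HasPd 0 u' (pd 0 u x + 2 * s * z x 1 * w x (Sum.inl 0)) x ∧
      HasPd 1 u' (pd 1 u x - 2 * s * z x 0 * w x (Sum.inl 1)) x := by
  have hne := h.sub_ne_zero_of_mem hx
  have key : ∀ i, HasPd i u' _ x := fun i =>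
    (((hasPd_const (2 : ℝ)).mul (((h.dz x hx i 0).sub (h.dz x hx i 1)).scomp
      (Real.hasDerivAt_log hne))).sub (hasPd_of_contDiffOn hu h.isOpen hx)).congr_on h.isOpen hx hu'
  refine ⟨(key 0).congr_deriv ?_, (key 1).congr_deriv ?_⟩
  · simp [offDiag]
    field_simp
    linear_combination (-2 * s * w x (Sum.inl 0)) * h.norm_z x hx
  · simp [offDiag]
    field_simp
    linear_combination (2 * s * w x (Sum.inl 1)) * h.norm_z x hx

theorem solvesGaussCodazzi (h : IsDressing O (offDiag u) G s w z) (hu : SolvesGaussCodazzi O u G)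
    (hu' : ∀ x ∈ O, u' x = 2 * Real.log (z x 0 - z x 1) - u x)
    (hG' : ∀ x ∈ O, ∀ a i, G' x a i =
      G x a i - 2 * s * lorentzSign i * z x i * w x (Sum.inr a)) :
    SolvesGaussCodazzi O u' G' where
  smooth_u := h.contDiffOn_newU hu.smooth_u hu'
  smooth_G a i := ((hu.smooth_G a i).sub ((contDiffOn_const.mul (h.smooth_z i)).mul
    (contDiffOn_euclidean.1 h.smooth_w _))).congr fun x hx => hG' x hx a i
  gauss x hx := by
    have h0 : HasPd 0 (pd 0 u') _ x :=
      ((hasPd_of_contDiffOn (contDiffOn_pd hu.smooth_u h.isOpen 0) h.isOpen hx).add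
      (((hasPd_const (2 * s)).mul (h.dz x hx 0 1)).mul (h.dw x hx 0 (Sum.inl 0)))).congr_on
      h.isOpen hx fun y hy => (h.hasPd_newU hu.smooth_u hu' hy).1.pd_eq
    have h1 : HasPd 1 (pd 1 u') _ x :=
      ((hasPd_of_contDiffOn (contDiffOn_pd hu.smooth_u h.isOpen 1) h.isOpen hx).sub
      (((hasPd_const (2 * s)).mul (h.dz x hx 1 0)).mul (h.dw x hx 1 (Sum.inl 1)))).congr_on
      h.isOpen hx fun y hy => (h.hasPd_newU hu.smooth_u hu' hy).2.pd_eq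
    rw [h0.pd_eq, h1.pd_eq]
    have hG2 : ∑ l, G' x l 0 * G' x l 1 = ∑ l, G x l 0 * G x l 1
        + 2 * s * z x 1 * ∑ l, G x l 0 * w x (Sum.inr l)
        - 2 * s * z x 0 * ∑ l, G x l 1 * w x (Sum.inr l)
        - 4 * s ^ 2 * z x 0 * z x 1 * ∑ l, w x (Sum.inr l) ^ 2 := by
      simp only [hG' x hx, Finset.mul_sum, ← Finset.sum_add_distrib, ← Finset.sum_sub_distrib]
      refine Finset.sum_congr rfl fun l _ => ?_
      simp only [lorentzSign_zero, lorentzSign_one]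
      ring
    have hw := h.sum_sq hx
    rw [Fintype.sum_sum_type, Fin.sum_univ_two] at hw
    rw [hG2]
    simp [offDiag, Fintype.sum_sum_type]
    -- What remains beyond the old Gauss equation is `4s² z₁ z₂ (1 - |w|²)`. The tangential part of
    -- `|w|²` comes from the second derivatives of `u'`, the normal part from the products of the
    -- new `g`.
    linear_combination hu.gauss x hx - 4 * s ^ 2 * z x 0 * z x 1 * hw
  codazzi₁ x hx l := by
    rw [(((hasPd_of_contDiffOn (hu.smooth_G l 0) h.isOpen hx).sub
      (((hasPd_const (2 * s * lorentzSign 0)).mul (h.dz x hx 1 0)).mul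
        (h.dw x hx 1 (Sum.inr l)))).congr_on h.isOpen hx fun y hy => hG' y hy l 0).pd_eq,
      (h.hasPd_newU hu.smooth_u hu' hx).2.pd_eq, hG' x hx, hu.codazzi₁ x hx]
    simp [offDiag]
    ring
  codazzi₂ x hx l := by
    rw [(((hasPd_of_contDiffOn (hu.smooth_G l 1) h.isOpen hx).sub
      (((hasPd_const (2 * s * lorentzSign 1)).mul (h.dz x hx 0 1)).mul
        (h.dw x hx 0 (Sum.inr l)))).congr_on h.isOpen hx fun y hy => hG' y hy l 1).pd_eq,
      (h.hasPd_newU hu.smooth_u hu' hx).1.pd_eq, hG' x hx, hu.codazzi₂ x hx]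
    simp [offDiag]
    ring

end IsDressing

/-! ### Isothermic pairs in terms of adapted surfaces -/

section Pairs

variable {k : ℕ} {O : Set Plane} {G : Plane → Matrix (Fin k) (Fin 2) ℝ} {u : Plane → ℝ}
  {F B : Plane → Matrix (Fin 2) (Fin 2) ℝ} {A : Plane → Matrix (Idx k) (Idx k) ℝ}
  {Y₁ Y₂ : Plane → Amb k}

/-- The equations for `B` are linear in each row, and left multiplication by `diag(±1, ±1)`
preserves `BᵗJB = J`. The row signs `σ` are needed because the first row of `B̃♮` is reversed. -/
theorem SolvesGaussCodazzi.solvesSystemII (h : SolvesGaussCodazzi O u G) (hO : IsOpen O)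
    (hF : ∀ x ∈ O, F x = offDiag u x) {σ : Fin 2 → ℝ} (hσ : ∀ i, σ i ^ 2 = 1)
    (hB : ∀ x ∈ O, ∀ i j, B x i j = σ i * hypRot u x i j) : SolvesSystemII O F G B := by
  have hFij : ∀ i j, ∀ x ∈ O, F x i j = offDiag u x i j := fun i j x hx => by rw [hF x hx]
  have hB' : ∀ x ∈ O, ∀ i j l, j ≠ l →
      HasPd l (fun y => B y i j) (F x l j * B x i l) x := by
    intro x hx i j l hjl
    have hu := hasPd_of_contDiffOn (i := l) h.smooth_u hO hx
    have hcosh := hu.scomp (Real.hasDerivAt_cosh (u x))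
    have hsinh := hu.scomp (Real.hasDerivAt_sinh (u x))
    rw [hFij _ _ x hx, hB x hx]
    have hc := ((hasPd_const (σ i)).mul hcosh)
    have hs := ((hasPd_const (σ i)).mul hsinh)
    refine HasPd.congr_on (f := fun y => σ i * hypRot u y i j) ?_ hO hx fun y hy => hB y hy i j
    fin_cases j <;> fin_cases l <;> first | exact absurd rfl hjl | skip
    all_goals
      fin_cases i <;> simp [hypRot, offDiag] at hc hs ⊢
      all_goals first | exact hc.congr_deriv (by ring) | exact hs.congr_deriv (by ring)
  refine ⟨fun i j => ?_, h.smooth_G, fun i j => ?_, fun x hx i => ?_, fun x hx => ?_, ?_, ?_, ?_⟩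
  · refine ContDiffOn.congr (f := fun x => offDiag u x i j) ?_ (hFij i j)
    have h0 := contDiffOn_pd h.smooth_u hO 0
    have h1 := contDiffOn_pd h.smooth_u hO 1
    fin_cases i <;> fin_cases j <;> simp [offDiag, contDiffOn_const] <;> assumption
  · refine ContDiffOn.congr (f := fun x => σ i * hypRot u x i j) (contDiffOn_const.mul ?_)
      fun x hx => hB x hx i j
    have h0 := h.smooth_u.cosh
    have h1 := h.smooth_u.sinh
    fin_cases i <;> fin_cases j <;> simp [hypRot] <;> assumption
  · rw [hF x hx]
    fin_cases i <;> simp [offDiag]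
  · have h0 := hσ 0
    have h1 := hσ 1
    have h2 := Real.cosh_sq_sub_sinh_sq (u x)
    ext i j
    fin_cases i <;> fin_cases j <;>
      simp [Matrix.mul_apply, J, hB x hx, hypRot, Matrix.diagonal_apply]
    · linear_combination Real.cosh (u x) ^ 2 * h0 - Real.sinh (u x) ^ 2 * h1 + h2
    · linear_combination Real.cosh (u x) * Real.sinh (u x) * (h0 - h1)
    · linear_combination Real.cosh (u x) * Real.sinh (u x) * (h0 - h1)
    · linear_combination Real.sinh (u x) ^ 2 * h0 - Real.cosh (u x) ^ 2 * h1 - h2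
  · intro x hx i j hij
    rw [pd_congr_on hO hx (hFij i j), pd_congr_on hO hx (hFij j i), hF x hx]
    have := h.gauss x hx
    fin_cases i <;> fin_cases j <;> first | exact absurd rfl hij | skip
    · simpa [offDiag] using this
    · simp only [mul_comm (G x _ 0)] at this
      simpa [offDiag, add_comm (pd 1 (pd 1 u) x)] using this
  · exact fun x hx i j l hjl => (hB' x hx i j l hjl).pd_eq
  · intro x hx a j l hjl
    rw [hF x hx]
    fin_cases j <;> fin_cases l <;> first | exact absurd rfl hjl | skip
    · simpa [offDiag] using h.codazzi₁ x hx a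
    · simpa [offDiag] using h.codazzi₂ x hx a

theorem toCols_mul_apply (A : Matrix (Idx k) (Idx k) ℝ) (B : Matrix (Fin 2) (Fin 2) ℝ) (i r : Fin 2)
    (a : Idx k) : (A.toCols₁ * C ℝ i * Bᵀ * J ℝ) a r =
      lorentzSign r * B r i * A a (Sum.inl i) := by
  rw [J, Matrix.mul_diagonal, C, Matrix.mul_assoc]
  fin_cases i <;> fin_cases r <;>
    simp [Matrix.mul_apply, Matrix.single_apply, mul_comm]

theorem IsIsothermicPairFor.contDiffOn (h : IsIsothermicPairFor O Y₁ Y₂ F G B A) :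
    ContDiffOn ℝ ∞ Y₁ O ∧ ContDiffOn ℝ ∞ Y₂ O := by
  have h0 := h.smooth_X 0
  have h1 := h.smooth_X 1
  simp only [Matrix.cons_val_zero, Matrix.cons_val_one] at h0 h1
  refine ⟨(h0.sub h1).congr fun x _ => ?_, (h0.add h1).congr fun x _ => ?_⟩
  · module
  · module

theorem pd_half (h₁ : ContDiffOn ℝ ∞ Y₁ O) (h₂ : ContDiffOn ℝ ∞ Y₂ O) (hO : IsOpen O) {x : Plane}
    (hx : x ∈ O) (i : Fin 2) :
    pd i (fun x => (1 / 2 : ℝ) • (Y₁ x + Y₂ x)) x = (1 / 2 : ℝ) • (pd i Y₁ x + pd i Y₂ x) ∧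
    pd i (fun x => (1 / 2 : ℝ) • (Y₂ x - Y₁ x)) x = (1 / 2 : ℝ) • (pd i Y₂ x - pd i Y₁ x) := by
  have d₁ := hasPd_of_contDiffOn (i := i) h₁ hO hx
  have d₂ := hasPd_of_contDiffOn (i := i) h₂ hO hx
  rw [((hasPd_const (1 / 2 : ℝ)).smul (d₁.add d₂)).pd_eq,
    ((hasPd_const (1 / 2 : ℝ)).smul (d₂.sub d₁)).pd_eq]
  simp

theorem IsIsothermicPairFor.pd_eq (h : IsIsothermicPairFor O Y₁ Y₂ F G B A) (hO : IsOpen O)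
    {x : Plane} (hx : x ∈ O) (i : Fin 2) :
    pd i Y₁ x = -(B x 0 i + B x 1 i) • column A (Sum.inl i) x ∧
      pd i Y₂ x = -(B x 0 i - B x 1 i) • column A (Sum.inl i) x := by
  obtain ⟨s₁, s₂⟩ := h.contDiffOn
  obtain ⟨e₁, e₂⟩ := pd_half s₁ s₂ hO hx i
  have h0 := h.dX x hx i 0
  have h1 := h.dX x hx i 1
  simp only [Matrix.cons_val_zero, Matrix.cons_val_one, e₁, e₂, toCols_mul_apply,
    PiLp.smul_apply, PiLp.add_apply, PiLp.sub_apply, smul_eq_mul, lorentzSign_zero,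
    lorentzSign_one] at h0 h1
  constructor <;> ext a <;> simp only [PiLp.smul_apply, smul_eq_mul, column]
  · linear_combination h0 a - h1 a
  · linear_combination h0 a + h1 a

theorem IsIsothermicPairFor.isAdapted (h : IsIsothermicPairFor O Y₁ Y₂ F G B A) (hO : IsOpen O)
    (h₁ : ∀ x ∈ O, ∀ i, B x 0 i + B x 1 i ≠ 0) (h₂ : ∀ x ∈ O, ∀ i, B x 0 i - B x 1 i ≠ 0) :
    IsAdapted O Y₁ (fun i x => -(B x 0 i + B x 1 i)) F G A ∧
      IsAdapted O Y₂ (fun i x => -(B x 0 i - B x 1 i)) F G A := by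
  have hB := h.solves.smooth_B
  refine ⟨⟨hO, h.contDiffOn.1, fun i => ((hB 0 i).add (hB 1 i)).neg, fun x hx i =>
    neg_ne_zero.2 (h₁ x hx i), h.smooth_A, h.orthogonal_A, h.dA, fun x hx i => (h.pd_eq hO hx i).1⟩,
    ⟨hO, h.contDiffOn.2, fun i => ((hB 0 i).sub (hB 1 i)).neg, fun x hx i =>
    neg_ne_zero.2 (h₂ x hx i), h.smooth_A, h.orthogonal_A, h.dA, fun x hx i => (h.pd_eq hO hx i).2⟩⟩

theorem isIsothermicPairFor_of_isAdapted {c₁ c₂ : Fin 2 → Plane → ℝ} (hB : SolvesSystemII O F G B)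
    (h₁ : IsAdapted O Y₁ c₁ F G A) (h₂ : IsAdapted O Y₂ c₂ F G A)
    (hc₁ : ∀ x ∈ O, ∀ i, c₁ i x = -(B x 0 i + B x 1 i))
    (hc₂ : ∀ x ∈ O, ∀ i, c₂ i x = -(B x 0 i - B x 1 i)) :
    IsIsothermicPairFor O Y₁ Y₂ F G B A where
  solves := hB
  smooth_X r := by
    fin_cases r
    · exact contDiffOn_const (c := (1 / 2 : ℝ)) |>.smul (h₁.smooth.add h₂.smooth)
    · exact contDiffOn_const (c := (1 / 2 : ℝ)) |>.smul (h₂.smooth.sub h₁.smooth)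
  smooth_A := h₁.smooth_A
  orthogonal_A := h₁.orthogonal
  dA := h₁.dA
  dX x hx i r a := by
    obtain ⟨e₁, e₂⟩ := pd_half h₁.smooth h₂.smooth h₁.isOpen hx i
    rw [toCols_mul_apply]
    rw [h₁.dY x hx, h₂.dY x hx, hc₁ x hx, hc₂ x hx] at e₁ e₂
    fin_cases r
    · refine (congrArg (fun v : Amb k => v a) e₁).trans ?_
      simp [column]
      ring
    · refine (congrArg (fun v : Amb k => v a) e₂).trans ?_
      simp [column]
      ring

/-- Changing the sign of the first frame vector. -/
theorem IsAdapted.flip {Y : Plane → Amb k} {c c' : Fin 2 → Plane → ℝ}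
    {F' : Plane → Matrix (Fin 2) (Fin 2) ℝ} {G' : Plane → Matrix (Fin k) (Fin 2) ℝ}
    {A' : Plane → Matrix (Idx k) (Idx k) ℝ} (h : IsAdapted O Y c F G A) {τ : Idx k → ℝ}
    (hτ : ∀ j, τ j ^ 2 = 1) (hA' : ∀ x a j, A' x a j = τ j * A x a j)
    (hξ : ∀ x ∈ O, ∀ j i, Matrix.fromRows (F' x) (G' x) j i =
      τ j * τ (Sum.inl i) * Matrix.fromRows (F x) (G x) j i)
    (hc' : ∀ i x, c' i x = τ (Sum.inl i) * c i x) : IsAdapted O Y c' F' G' A' where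
  isOpen := h.isOpen
  smooth := h.smooth
  smooth_c i := (contDiffOn_const.mul (h.smooth_c i)).congr fun x _ => hc' i x
  c_ne_zero x hx i := by
    rw [hc']
    exact mul_ne_zero (fun h0 => by simpa [h0] using hτ (Sum.inl i)) (h.c_ne_zero x hx i)
  smooth_A a j := (contDiffOn_const.mul (h.smooth_A a j)).congr fun x _ => hA' x a j
  orthogonal x hx := by
    ext i j
    have := congrFun (congrFun (h.orthogonal x hx) i) j
    simp only [Matrix.mul_apply, Matrix.transpose_apply, hA'] at this ⊢
    calc ∑ l, τ i * A x l i * (τ j * A x l j) = τ i * τ j * ∑ l, A x l i * A x l j := by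
          rw [Finset.mul_sum]
          exact Finset.sum_congr rfl fun l _ => by ring
      _ = (1 : Matrix (Idx k) (Idx k) ℝ) i j := by
          rw [this, Matrix.one_apply]
          split_ifs with hij
          · rw [← hij, mul_one, ← sq, hτ]
          · rw [mul_zero]
  dA x hx i := by
    ext a j
    have h1 := congrFun (congrFun (h.dA x hx i) a) j
    rw [pdMat, Matrix.of_apply] at h1 ⊢
    simp only [hA']
    rw [((hasPd_const (τ j)).mul (hasPd_of_contDiffOn (h.smooth_A a j) h.isOpen hx)).pd_eq, h1,
      zero_mul, zero_add, Matrix.mul_apply, Matrix.mul_apply, Finset.mul_sum]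
    refine Finset.sum_congr rfl fun b _ => ?_
    rw [hA', omega_eq, omega_eq, hξ x hx, hξ x hx]
    have hb := hτ b
    have hi := hτ (Sum.inl i)
    split_ifs with hbi hji hji
    · subst hbi hji
      ring
    · subst hbi
      linear_combination (-τ j * A x a (Sum.inl i) * Matrix.fromRows (F x) (G x) j i) * hi
    · subst hji
      linear_combination (τ (Sum.inl i) * A x a b * Matrix.fromRows (F x) (G x) b i) * hb
    · ring
  dY x hx i := by
    rw [h.dY x hx, hc']
    ext a
    have hi := hτ (Sum.inl i)
    simp only [PiLp.smul_apply, smul_eq_mul, column, hA']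
    linear_combination (-c i x * A x a (Sum.inl i)) * hi

/-- A pair of surfaces with `dY₁ = e^{-u} (dx e₁ - dy e₂)` and `dY₂ = e^u (dx e₁ + dy e₂)` is
isothermic. -/
theorem isIsothermicPair_of_isAdapted (hu : SolvesGaussCodazzi O u G)
    (hF : ∀ x ∈ O, F x = offDiag u x)
    (h₁ : IsAdapted O Y₁ (fun i x => lorentzSign i * Real.exp (-u x)) F G A)
    (h₂ : IsAdapted O Y₂ (fun _ x => Real.exp (u x)) F G A) : IsIsothermicPair O Y₁ Y₂ := by
  have hneg : ∀ i, ∀ x ∈ O, pd i (fun y => -u y) x = -pd i u x := fun i x hx =>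
    (hasPd_of_contDiffOn hu.smooth_u h₁.isOpen hx).neg.pd_eq
  have hneg2 : ∀ i, ∀ x ∈ O, pd i (pd i fun y => -u y) x = -pd i (pd i u) x := fun i x hx => by
    rw [pd_congr_on h₁.isOpen hx (hneg i)]
    exact (hasPd_of_contDiffOn (contDiffOn_pd hu.smooth_u h₁.isOpen i) h₁.isOpen hx).neg.pd_eq
  -- The equations are invariant under `(u, g_{l1}, g_{l2}) ↦ (-u, -g_{l1}, g_{l2})`. This exchanges
  -- the exponents, as the normal form of an isothermic pair requires.
  have hS : SolvesGaussCodazzi O (fun y => -u y)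
      (fun x => Matrix.of fun a i => -lorentzSign i * G x a i) := by
    refine ⟨hu.smooth_u.neg, fun a i => contDiffOn_const.mul (hu.smooth_G a i), fun x hx => ?_,
      fun x hx l => ?_, fun x hx l => ?_⟩
    · rw [hneg2 0 x hx, hneg2 1 x hx]
      have := hu.gauss x hx
      simp only [Matrix.of_apply, lorentzSign_zero, lorentzSign_one, neg_neg, one_mul, neg_mul,
        Finset.sum_neg_distrib]
      linarith
    · have := hu.codazzi₁ x hx l
      have h2 := (hasPd_of_contDiffOn (i := 1) (hu.smooth_G l 0) h₁.isOpen hx).neg.pd_eq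
      simp only [Matrix.of_apply, lorentzSign_zero, lorentzSign_one, neg_mul, one_mul, neg_neg]
      rw [h2, hneg 1 x hx, this]
      ring
    · have := hu.codazzi₂ x hx l
      simp only [Matrix.of_apply, lorentzSign_zero, lorentzSign_one, neg_mul, one_mul, neg_neg]
      rw [hneg 0 x hx, this]
      ring
  -- The accompanying frame change is `e₁ ↦ -e₁`, with all other vectors fixed.
  let τ : Idx k → ℝ := Sum.elim (fun i => -lorentzSign i) fun _ => 1
  let A' : Plane → Matrix (Idx k) (Idx k) ℝ := fun x => Matrix.of fun a j => τ j * A x a j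
  have hτ : ∀ j, τ j ^ 2 = 1 := by
    rintro (j | j)
    · fin_cases j <;> simp [τ]
    · simp [τ]
  have hξ : ∀ x ∈ O, ∀ j i, Matrix.fromRows (offDiag (fun y => -u y) x)
      (Matrix.of fun a i => -lorentzSign i * G x a i) j i =
      τ j * τ (Sum.inl i) * Matrix.fromRows (F x) (G x) j i := by
    rintro x hx (j | j) i
    · rw [hF x hx]
      fin_cases i <;> fin_cases j <;> simp [τ, offDiag, hneg _ x hx]
    · simp [τ]
  refine ⟨fun y => -u y, fun x => Matrix.of fun a i => -lorentzSign i * G x a i, A', hS,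
    isIsothermicPairFor_of_isAdapted
    (hS.solvesSystemII h₁.isOpen (fun _ _ => rfl) (σ := fun _ => 1) (by simp) (by simp))
    (h₁.flip (A' := A') hτ (fun _ _ _ => rfl) hξ fun _ _ => rfl)
    (h₂.flip (A' := A') hτ (fun _ _ _ => rfl) hξ fun _ _ => rfl)
    (fun x hx i => ?_) fun x hx i => ?_⟩
  · have e := Real.cosh_sub_sinh (u x)
    fin_cases i <;> simp [τ, hypRot] <;> linarith
  · fin_cases i <;> simp [τ, hypRot]

end Pairs

/-! ### Frames of the Lax connection and the moved line -/

section Frame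

variable {k : ℕ} {O : Set Plane} {ξ : Plane → Matrix (Idx k) (Fin 2) ℝ}
  {E : Plane → ℂ → Matrix (Idx k ⊕ Fin 2) (Idx k ⊕ Fin 2) ℂ} {s : ℝ} {W : Amb k} {Z : Fin 2 → ℝ}
  {x : Plane}

theorem sigLorentz_eq_diagonal : sigLorentz k =
    Matrix.diagonal (Sum.elim (fun _ => 1) fun j => (lorentzSign j : ℂ)) := by
  rw [sigLorentz, J, ← Matrix.diagonal_one, Matrix.fromBlocks_diagonal]
  congr 2
  ext j
  fin_cases j <;> simp

theorem sigCartan_eq_diagonal : sigCartan k =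
    Matrix.diagonal (Sum.elim (fun _ => 1) fun _ => -1) := by
  rw [sigCartan, ← Matrix.diagonal_one, ← Matrix.diagonal_one, Matrix.diagonal_neg,
    Matrix.fromBlocks_diagonal]

theorem sigLorentz_mul_self : sigLorentz k * sigLorentz k = 1 := by
  rw [sigLorentz_eq_diagonal, Matrix.diagonal_mul_diagonal, ← Matrix.diagonal_one]
  congr 1
  ext j
  rcases j with j | j
  · simp
  · fin_cases j <;> simp

theorem sigCartan_mul_self : sigCartan k * sigCartan k = 1 := by
  rw [sigCartan_eq_diagonal, Matrix.diagonal_mul_diagonal, ← Matrix.diagonal_one]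
  congr 1
  ext j
  rcases j with j | j <;> simp

theorem IsFrame.left_inv (h : IsFrame O ξ E) (hx : x ∈ O) (lam : ℂ) :
    (sigLorentz k * (E x lam)ᵀ * sigLorentz k) * E x lam = 1 := by
  rw [Matrix.mul_assoc, Matrix.mul_assoc, ← Matrix.mul_assoc (E x lam)ᵀ, h.orthogonal x hx,
    sigLorentz_mul_self]

theorem IsFrame.inv_eq (h : IsFrame O ξ E) (hx : x ∈ O) (lam : ℂ) :
    (E x lam)⁻¹ = sigLorentz k * (E x lam)ᵀ * sigLorentz k :=
  Matrix.inv_eq_left_inv (h.left_inv hx lam)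

theorem IsFrame.isUnit_det (h : IsFrame O ξ E) (hx : x ∈ O) (lam : ℂ) : IsUnit (E x lam).det :=
  Matrix.isUnit_det_of_left_inverse (h.left_inv hx lam)

theorem IsFrame.mulVec_movedVec (h : IsFrame O ξ E) (hx : x ∈ O) :
    E x (-(Complex.I * s)) *ᵥ movedVec E s W Z x = initVec W Z := by
  rw [movedVec, Matrix.mulVec_mulVec, Matrix.mul_nonsing_inv _ (h.isUnit_det hx _),
    Matrix.one_mulVec]

theorem IsFrame.contDiffOn_movedVec (h : IsFrame O ξ E) (a : Idx k ⊕ Fin 2) :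
    ContDiffOn ℝ ∞ (fun y => movedVec E s W Z y a) O := by
  refine ContDiffOn.congr (f := fun y => ((sigLorentz k * (E y (-(Complex.I * s)))ᵀ *
    sigLorentz k) *ᵥ initVec W Z) a) ?_ fun y hy => by rw [movedVec, h.inv_eq hy]
  simp only [sigLorentz_eq_diagonal, Matrix.mulVec, dotProduct, Matrix.mul_diagonal,
    Matrix.diagonal_mul, Matrix.transpose_apply]
  exact ContDiffOn.sum fun b _ =>
    ((contDiffOn_const.mul (h.smooth _ b a)).mul contDiffOn_const).mul contDiffOn_const

/-- Differentiating the constant `E v = (W, iZ)` gives `E (L v + ∂ᵢv) = 0`, and `E` is invertible.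
-/
theorem IsFrame.hasPd_movedVec (h : IsFrame O ξ E) (hO : IsOpen O) (hx : x ∈ O) (i : Fin 2)
    (a : Idx k ⊕ Fin 2) : HasPd i (fun y => movedVec E s W Z y a)
      (-(lax (ξ x) (-(Complex.I * s)) i *ᵥ movedVec E s W Z x) a) x := by
  set v := movedVec E s W Z
  set L := lax (ξ x) (-(Complex.I * s)) i
  have hv : ∀ b, HasPd i (fun y => v y b) (pd i (fun y => v y b) x) x := fun b =>
    hasPd_of_contDiffOn (h.contDiffOn_movedVec b) hO hx
  refine (hv a).congr_deriv ?_
  have h1 : ∀ c, (E x (-(Complex.I * s)) *ᵥ (L *ᵥ v x + fun b => pd i (fun y => v y b) x)) c = 0 := by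
    intro c
    have e1 := HasPd.sum (s := Finset.univ) fun b _ =>
      (hasPd_of_contDiffOn (i := i) (h.smooth (-(Complex.I * s)) c b) hO hx).mul (hv b)
    have e2 := (e1.congr_on hO hx (g := fun _ => initVec W Z c) fun y hy =>
      (congrFun (h.mulVec_movedVec hy) c).symm).pd_eq
    rw [(hasPd_const (initVec W Z c)).pd_eq, Finset.sum_add_distrib] at e2
    rw [Matrix.mulVec_add, Matrix.mulVec_mulVec, ← h.trivializes _ x hx i]
    exact e2.symm
  have h2 := congrArg ((E x (-(Complex.I * s)))⁻¹ *ᵥ ·) (funext h1)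
  simp only [Matrix.mulVec_mulVec, Matrix.nonsing_inv_mul _ (h.isUnit_det hx _),
    Matrix.one_mulVec] at h2
  have h3 := congrFun h2 a
  rw [Pi.add_apply, show (fun _ : Idx k ⊕ Fin 2 => (0 : ℂ)) = 0 from rfl, Matrix.mulVec_zero] at h3
  exact (neg_eq_of_add_eq_zero_right h3).symm

/-- Reality and twisting combine to `conj E(-is) = E(is) = I_{m,2} E(-is) I_{m,2}`. Hence `E(-is)⁻¹`
preserves the real subspace `conj v = I_{m,2} v`, which consists of the vectors `(w, iz)` with `w`,
`z` real. -/
theorem IsFrame.movedVec_eq (h : IsFrame O ξ E) (hx : x ∈ O) :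
    movedVec E s W Z x = initVec (tildeW E s W Z x) (tildeZ E s W Z x) := by
  have hconj : ∀ v : Idx k ⊕ Fin 2 → ℂ, (starRingEnd ℂ ∘ v = sigCartan k *ᵥ v) →
      v = Sum.elim (fun j => ((v (Sum.inl j)).re : ℂ))
        fun j => Complex.I * ((v (Sum.inr j)).im : ℂ) := by
    intro v hv
    rw [sigCartan_eq_diagonal] at hv
    ext j
    have := congrFun hv j
    rw [Matrix.mulVec_diagonal] at this
    rcases j with j | j
    · simp only [Function.comp, Sum.elim_inl, one_mul] at this
      exact (Complex.conj_eq_iff_re.1 this).symm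
    · simp only [Function.comp, Sum.elim_inr, neg_one_mul] at this
      have hre := congrArg Complex.re this
      simp only [Complex.conj_re, Complex.neg_re] at hre
      apply Complex.ext <;> simp
      linarith
  refine hconj _ ?_
  set M := E x (-(Complex.I * s)) with hM
  have hMc : M.map (starRingEnd ℂ) = sigCartan k * M * sigCartan k := by
    rw [hM, h.twisted x hx, neg_neg, ← h.real x hx (Complex.I * s)]
    congr 2
    simp
  have h0 : starRingEnd ℂ ∘ initVec W Z = sigCartan k *ᵥ initVec W Z := by
    rw [sigCartan_eq_diagonal]
    ext j
    rw [Matrix.mulVec_diagonal]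
    rcases j with j | j <;> simp [initVec]
  have h1 : starRingEnd ℂ ∘ (M *ᵥ movedVec E s W Z x)
      = M.map (starRingEnd ℂ) *ᵥ (starRingEnd ℂ ∘ movedVec E s W Z x) := by
    ext j
    simp [Matrix.mulVec, dotProduct]
  rw [h.mulVec_movedVec hx, h0, hMc] at h1
  have h2 := congrArg (fun v => M⁻¹ *ᵥ (sigCartan k *ᵥ v)) h1
  simp only [Matrix.mulVec_mulVec, sigCartan_mul_self] at h2
  rw [← Matrix.mul_assoc (sigCartan k), ← Matrix.mul_assoc (sigCartan k), sigCartan_mul_self,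
    Matrix.one_mul, ← Matrix.mul_assoc, Matrix.nonsing_inv_mul _ (h.isUnit_det hx _),
    Matrix.one_mul, Matrix.mul_one] at h2
  have h3 := congrArg (sigCartan k *ᵥ ·) h2
  simp only [Matrix.mulVec_mulVec, sigCartan_mul_self, Matrix.one_mulVec] at h3
  rw [← Matrix.mulVec_mulVec] at h3
  exact h3.symm

/-- On `(w, iz)` the bilinear form of `I_{m+1,1}` is `‖w‖² - (z₁² - z₂²)`. It vanishes on `(W, iZ)`
and is preserved by `E`. -/
theorem IsFrame.norm_tilde (h : IsFrame O ξ E) (hW : ‖W‖ = 1) (hZ : Z 0 ^ 2 - Z 1 ^ 2 = 1)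
    (hx : x ∈ O) :
    ‖tildeW E s W Z x‖ ^ 2 = tildeZ E s W Z x 0 ^ 2 - tildeZ E s W Z x 1 ^ 2 := by
  have hq : ∀ (w : Amb k) (z : Fin 2 → ℝ), initVec w z ⬝ᵥ (sigLorentz k *ᵥ initVec w z)
      = ((‖w‖ ^ 2 - (z 0 ^ 2 - z 1 ^ 2) : ℝ) : ℂ) := by
    intro w z
    rw [sigLorentz_eq_diagonal, EuclideanSpace.real_norm_sq_eq]
    simp only [dotProduct, Matrix.mulVec_diagonal, Fintype.sum_sum_type (α₁ := Idx k), initVec,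
      Sum.elim_inl, Sum.elim_inr, Fin.sum_univ_two, lorentzSign_zero, lorentzSign_one]
    push_cast
    have := Complex.I_sq
    rw [sub_eq_add_neg]
    congr 1
    · exact Finset.sum_congr rfl fun j _ => by ring
    · linear_combination ((z 0 : ℂ) ^ 2 - z 1 ^ 2) * this
  have h1 : movedVec E s W Z x ⬝ᵥ (sigLorentz k *ᵥ movedVec E s W Z x)
      = initVec W Z ⬝ᵥ (sigLorentz k *ᵥ initVec W Z) := by
    rw [← h.mulVec_movedVec (s := s) hx]
    conv_lhs => rw [← h.orthogonal x hx (-(Complex.I * s))]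
    rw [← Matrix.mulVec_mulVec, ← Matrix.mulVec_mulVec, Matrix.dotProduct_mulVec,
      Matrix.vecMul_transpose]
  rw [h.movedVec_eq hx, hq, hq, hW, hZ] at h1
  have h2 := Complex.ofReal_injective h1
  linarith

/-- The factor `i` of `λ = -is` meets the `i` in front of `z`, so the equation for `(w, iz)` is a
real one for `(w, z)`. -/
theorem lax_mulVec_inl (X : Matrix (Idx k) (Fin 2) ℝ) (i : Fin 2) (w : Amb k) (z : Fin 2 → ℝ)
    (a : Idx k) : (lax X (-(Complex.I * s)) i *ᵥ initVec w z) (Sum.inl a) =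
      (((if a = Sum.inl i then ∑ b, X b i * w b - s * lorentzSign i * z i else 0)
        - X a i * w (Sum.inl i) : ℝ) : ℂ) := by
  have h11 : ∀ b, (D ℂ k i * (X.map Complex.ofReal)ᵀ - X.map Complex.ofReal * (D ℂ k i)ᵀ) a b =
      (if a = Sum.inl i then (X b i : ℂ) else 0) - if b = Sum.inl i then (X a i : ℂ) else 0 := by
    intro b
    fin_cases i <;> simp [D, Matrix.mul_apply, Matrix.single_apply, eq_comm]
  have h12 : ∀ j, (-(-(Complex.I * s) • (D ℂ k i * J ℂ))) a j =
      if a = Sum.inl i ∧ j = i then Complex.I * s * lorentzSign i else 0 := by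
    intro j
    by_cases ha : a = Sum.inl i
    · subst ha
      fin_cases i <;> fin_cases j <;> simp [D, J]
    · simp [D, J, Ne.symm ha, ha]
  simp only [lax, Matrix.mulVec, dotProduct, Fintype.sum_sum_type (α₁ := Idx k), initVec,
    Sum.elim_inl, Sum.elim_inr, Matrix.fromBlocks_apply₁₁, Matrix.fromBlocks_apply₁₂, h11, h12]
  have hI : Complex.I * s * lorentzSign i * (Complex.I * z i) = -(s * lorentzSign i * z i) := by
    linear_combination (s * lorentzSign i * z i : ℂ) * Complex.I_mul_I
  by_cases ha : a = Sum.inl i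
  · simp only [ha, true_and, if_true, ite_mul, zero_mul, Finset.sum_ite_eq', Finset.mem_univ, hI,
      sub_mul, Finset.sum_sub_distrib]
    push_cast
    ring
  · simp [ha]

theorem lax_mulVec_inr (X : Matrix (Idx k) (Fin 2) ℝ) (i : Fin 2) (w : Amb k) (z : Fin 2 → ℝ)
    (j : Fin 2) : (lax X (-(Complex.I * s)) i *ᵥ initVec w z) (Sum.inr j) =
      Complex.I * (((if j = i then ∑ l, X (Sum.inl i) l * z l - s * w (Sum.inl i) else 0)
        - lorentzSign j * lorentzSign i * X (Sum.inl i) j * z i : ℝ) : ℂ) := by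
  have h21 : ∀ b, (-(Complex.I * s) • (D ℂ k i)ᵀ) j b =
      if b = Sum.inl i ∧ j = i then -(Complex.I * s) else 0 := by
    intro b
    simp [D, Matrix.single_apply, eq_comm, and_comm]
  have h22 : ∀ l, (-(J ℂ * (X.map Complex.ofReal)ᵀ * D ℂ k i * J ℂ)
      + (D ℂ k i)ᵀ * X.map Complex.ofReal) j l =
      (if j = i then (X (Sum.inl i) l : ℂ) else 0)
        - if l = i then (lorentzSign j * lorentzSign i * X (Sum.inl i) j : ℂ) else 0 := by
    intro l
    rw [J, Matrix.add_apply, Matrix.neg_apply, Matrix.mul_diagonal, Matrix.mul_assoc,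
      Matrix.diagonal_mul]
    fin_cases i <;> fin_cases j <;> fin_cases l <;>
      simp [D, Matrix.mul_apply, Matrix.single_apply]
  simp only [lax, Matrix.mulVec, dotProduct, Fintype.sum_sum_type (α₁ := Idx k), initVec,
    Sum.elim_inl, Sum.elim_inr, Matrix.fromBlocks_apply₂₁, Matrix.fromBlocks_apply₂₂, h21, h22]
  by_cases hj : j = i
  · simp only [hj, and_true, if_true, ite_mul, zero_mul, Finset.sum_ite_eq', Finset.mem_univ,
      sub_mul, Finset.sum_sub_distrib]
    push_cast
    rw [mul_sub, mul_sub, Finset.mul_sum, Finset.sum_congr rfl fun l _ => mul_left_comm _ _ _]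
    ring
  · simp [hj]
    ring

theorem IsFrame.hasPd_tildeW (h : IsFrame O ξ E) (hO : IsOpen O) (hx : x ∈ O) (i : Fin 2)
    (a : Idx k) : HasPd i (fun y => tildeW E s W Z y a)
      ((if a = Sum.inl i then s * lorentzSign i * tildeZ E s W Z x i
          - ∑ b, ξ x b i * tildeW E s W Z x b else 0)
        + ξ x a i * tildeW E s W Z x (Sum.inl i)) x := by
  refine ((h.hasPd_movedVec (s := s) (W := W) (Z := Z) hO hx i (Sum.inl a)).clm
    Complex.reCLM).congr_deriv ?_
  rw [h.movedVec_eq hx, lax_mulVec_inl, Complex.reCLM_apply, ← Complex.ofReal_neg,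
    Complex.ofReal_re]
  split_ifs <;> ring

theorem IsFrame.hasPd_tildeZ (h : IsFrame O ξ E) (hO : IsOpen O) (hx : x ∈ O) (i : Fin 2)
    (j : Fin 2) : HasPd i (fun y => tildeZ E s W Z y j)
      ((if j = i then s * tildeW E s W Z x (Sum.inl i)
          - ∑ l, ξ x (Sum.inl i) l * tildeZ E s W Z x l else 0)
        + lorentzSign j * lorentzSign i * ξ x (Sum.inl i) j * tildeZ E s W Z x i) x := by
  refine ((h.hasPd_movedVec (s := s) (W := W) (Z := Z) hO hx i (Sum.inr j)).clm
    Complex.imCLM).congr_deriv ?_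
  rw [h.movedVec_eq hx, lax_mulVec_inr, Complex.imCLM_apply, Complex.neg_im, Complex.im_mul_ofReal,
    Complex.I_im]
  split_ifs <;> ring

theorem IsFrame.contDiffOn_tildeW (h : IsFrame O ξ E) : ContDiffOn ℝ ∞ (tildeW E s W Z) O :=
  contDiffOn_toLp fun _ => Complex.reCLM.contDiff.comp_contDiffOn (h.contDiffOn_movedVec _)

theorem IsFrame.contDiffOn_tildeZ (h : IsFrame O ξ E) (j : Fin 2) :
    ContDiffOn ℝ ∞ (fun y => tildeZ E s W Z y j) O :=
  Complex.imCLM.contDiff.comp_contDiffOn (h.contDiffOn_movedVec _)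

theorem IsFrame.isOpen_regularSet (h : IsFrame O ξ E) (hO : IsOpen O) :
    IsOpen (regularSet E s W Z O) :=
  h.contDiffOn_tildeW.continuousOn.isOpen_inter_preimage hO isOpen_compl_singleton

theorem IsFrame.hatZ_eq (h : IsFrame O ξ E) (hW : ‖W‖ = 1) (hZ : Z 0 ^ 2 - Z 1 ^ 2 = 1)
    (hx : x ∈ O) (j : Fin 2) :
    hatZ E s W Z x j = ‖tildeW E s W Z x‖⁻¹ * tildeZ E s W Z x j := by
  rw [hatZ, ← h.norm_tilde hW hZ hx, Real.sqrt_sq (norm_nonneg _), div_eq_inv_mul]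

/-- The norm is computed as `(z̃₁² - z̃₂²)^{1/2}`, which has only two terms. The contributions of
`F` cancel in the derivative of `z̃₁² - z̃₂²`. -/
theorem IsFrame.hasPd_inv_norm (h : IsFrame O ξ E) (hO : IsOpen O) (hW : ‖W‖ = 1)
    (hZ : Z 0 ^ 2 - Z 1 ^ 2 = 1) (hx : x ∈ O) (hx' : tildeW E s W Z x ≠ 0) (i : Fin 2) :
    HasPd i (fun y => ‖tildeW E s W Z y‖⁻¹) (-(s * lorentzSign i * hatZ E s W Z x i *
      hatW E s W Z x (Sum.inl i) * ‖tildeW E s W Z x‖⁻¹)) x := by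
  have hn : ‖tildeW E s W Z x‖ ≠ 0 := norm_ne_zero_iff.2 hx'
  have hN := h.norm_tilde hW hZ (s := s) hx
  have hN0 : tildeZ E s W Z x 0 ^ 2 - tildeZ E s W Z x 1 ^ 2 ≠ 0 := by
    rw [← hN]
    exact pow_ne_zero 2 hn
  have hφ := (Real.hasDerivAt_sqrt hN0).inv (by rw [← hN, Real.sqrt_sq (norm_nonneg _)]; exact hn)
  have hz := fun j => h.hasPd_tildeZ (s := s) (W := W) (Z := Z) hO hx i j
  have hd := (((hz 0).mul (hz 0)).sub ((hz 1).mul (hz 1))).congr_on hO hx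
    (g := fun y => tildeZ E s W Z y 0 ^ 2 - tildeZ E s W Z y 1 ^ 2) fun y _ => by ring
  refine ((HasPd.scomp hφ hd).congr_on hO hx fun y hy => ?_).congr_deriv ?_
  · rw [Pi.inv_apply, ← h.norm_tilde hW hZ hy, Real.sqrt_sq (norm_nonneg _)]
  · rw [h.hatZ_eq hW hZ hx, ← hN, Real.sqrt_sq (norm_nonneg _), hatW, PiLp.smul_apply, smul_eq_mul]
    field_simp
    fin_cases i <;> simp <;> ring

/-- Apart from the terms produced by the derivative of `‖W̃‖⁻¹`, which are the quadratic ones in `s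
Jᵢ zᵢ wᵢ`, the system is linear and commutes with the scaling. -/
theorem IsFrame.isDressing {F : Plane → Matrix (Fin 2) (Fin 2) ℝ}
    {G : Plane → Matrix (Fin k) (Fin 2) ℝ}
    (h : IsFrame O (fun x => Matrix.fromRows (F x) (G x)) E) (hO : IsOpen O) (hW : ‖W‖ = 1)
    (hZ : Z 0 ^ 2 - Z 1 ^ 2 = 1) :
    IsDressing (regularSet E s W Z O) F G s (hatW E s W Z) (hatZ E s W Z) := by
  have hinv : ContDiffOn ℝ ∞ (fun x => ‖tildeW E s W Z x‖⁻¹) (regularSet E s W Z O) :=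
    ((h.contDiffOn_tildeW.mono fun _ hx => hx.1).norm ℝ fun _ hx => hx.2).inv
      fun _ hx => norm_ne_zero_iff.2 hx.2
  have hO' := h.isOpen_regularSet (s := s) (W := W) (Z := Z) hO
  refine ⟨hO', hinv.smul (h.contDiffOn_tildeW.mono fun _ hx => hx.1),
    fun j => (hinv.mul ((h.contDiffOn_tildeZ j).mono fun _ hx => hx.1)).congr fun x hx =>
      h.hatZ_eq hW hZ hx.1 j, fun x hx => ?_, fun x hx => ?_, fun x hx i a => ?_,
      fun x hx i j => ?_⟩
  · rw [hatW, norm_smul, norm_inv, norm_norm, inv_mul_cancel₀ (norm_ne_zero_iff.2 hx.2)]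
  · rw [h.hatZ_eq hW hZ hx.1, h.hatZ_eq hW hZ hx.1, mul_pow, mul_pow, ← mul_sub,
      ← h.norm_tilde hW hZ hx.1, ← mul_pow, inv_mul_cancel₀ (norm_ne_zero_iff.2 hx.2), one_pow]
  · refine ((h.hasPd_inv_norm hO hW hZ hx.1 hx.2 i).mul
      (h.hasPd_tildeW hO hx.1 i a)).congr_deriv ?_
    have e : ∀ b, hatW E s W Z x b = ‖tildeW E s W Z x‖⁻¹ * tildeW E s W Z x b := fun b => rfl
    simp only [e, h.hatZ_eq hW hZ hx.1]
    split_ifs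
    · simp only [mul_left_comm _ ‖tildeW E s W Z x‖⁻¹, ← Finset.mul_sum]
      ring
    · ring
  · refine (((h.hasPd_inv_norm hO hW hZ hx.1 hx.2 i).mul (h.hasPd_tildeZ hO hx.1 i j)).congr_on
      hO' hx fun y hy => h.hatZ_eq hW hZ hy.1 j).congr_deriv ?_
    have e : ∀ b, hatW E s W Z x b = ‖tildeW E s W Z x‖⁻¹ * tildeW E s W Z x b := fun b => rfl
    simp only [e, h.hatZ_eq hW hZ hx.1, Matrix.fromRows_apply_inl]
    split_ifs
    · simp only [mul_left_comm _ ‖tildeW E s W Z x‖⁻¹, ← Finset.mul_sum]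
      ring
    · ring

end Frame

/-! ### The new frame at `λ = 0` -/

section NewFrame

variable {k : ℕ} {O : Set Plane} {ξ : Plane → Matrix (Idx k) (Fin 2) ℝ}
  {E : Plane → ℂ → Matrix (Idx k ⊕ Fin 2) (Idx k ⊕ Fin 2) ℂ} {s : ℝ} {W : Amb k} {Z : Fin 2 → ℝ}
  {x : Plane}

theorem realBlocks_mul (A A' : Matrix (Idx k) (Idx k) ℝ) (B B' : Matrix (Fin 2) (Fin 2) ℝ) :
    realBlocks A B * realBlocks A' B' = realBlocks (A * A') (B * B') := by
  simp only [realBlocks, Matrix.fromBlocks_multiply, Matrix.mul_zero, Matrix.zero_mul, add_zero,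
    zero_add]
  congr 1
  · exact (Matrix.map_mul (f := Complex.ofRealHom)).symm
  · exact (Matrix.map_mul (f := Complex.ofRealHom)).symm

theorem realBlocks_one : realBlocks (1 : Matrix (Idx k) (Idx k) ℝ) 1 = 1 := by
  simp [realBlocks]

/-- At `λ = 0`, `q_{s,π}` is a pair of reflections. -/
theorem qMap_zero (hs : s ≠ 0) {w : Amb k} {z : Fin 2 → ℝ} {n : ℝ} (hn : n ≠ 0)
    (hw : ‖w‖ ^ 2 = n) (hz : z 0 ^ 2 - z 1 ^ 2 = n) :
    qMap s (projOnto (initVec w z)) 0 =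
      realBlocks (1 - (2 / n) • Matrix.vecMulVec w.ofLp w.ofLp)
        (1 - (2 / n) • (Matrix.vecMulVec z z * J ℝ)) := by
  set p : Idx k ⊕ Fin 2 → ℂ := initVec w z with hp
  set q : Idx k ⊕ Fin 2 → ℂ := star p ᵥ* sigLorentz k with hq
  have hq' : q = Sum.elim (fun j => (w j : ℂ))
      fun j => -(Complex.I * (lorentzSign j * z j : ℝ)) := by
    rw [hq, sigLorentz_eq_diagonal]
    ext j
    rw [Matrix.vecMul_diagonal]
    rcases j with j | j <;> simp [hp, initVec]
    ring
  have hw' : ∑ j, (w j : ℂ) * (w j : ℂ) = n := by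
    rw [← hw, EuclideanSpace.real_norm_sq_eq]
    push_cast
    exact Finset.sum_congr rfl fun j _ => (sq _).symm
  have hz' : (z 0 : ℂ) ^ 2 - (z 1 : ℂ) ^ 2 = n := by
    rw [← hz]
    push_cast
    rfl
  have hqp : q ⬝ᵥ p = 2 * n := by
    rw [hq']
    simp only [dotProduct, Fintype.sum_sum_type (α₁ := Idx k), hp, initVec, Sum.elim_inl,
      Sum.elim_inr, Fin.sum_univ_two, hw', lorentzSign_zero, lorentzSign_one]
    push_cast
    linear_combination hz' - ((z 0 : ℂ) ^ 2 - (z 1 : ℂ) ^ 2) * Complex.I_sq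
  -- Since `p` is null for the bilinear form, `p̄` is orthogonal to `p` in the Hermitian form,
  -- whence `π π̄ = 0`.
  have hqp' : q ⬝ᵥ (starRingEnd ℂ ∘ p) = 0 := by
    rw [hq']
    simp only [dotProduct, Fintype.sum_sum_type (α₁ := Idx k), hp, initVec, Sum.elim_inl,
      Sum.elim_inr, Fin.sum_univ_two, Function.comp, map_mul, Complex.conj_ofReal, Complex.conj_I,
      hw', lorentzSign_zero, lorentzSign_one]
    push_cast
    linear_combination -hz' + ((z 0 : ℂ) ^ 2 - (z 1 : ℂ) ^ 2) * Complex.I_sq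
  have hπ : projOnto p = (2 * n : ℂ)⁻¹ • Matrix.vecMulVec p q := by
    rw [projOnto, Matrix.dotProduct_mulVec, ← hq, hqp]
  have hπc : (projOnto p).map (starRingEnd ℂ) =
      (2 * n : ℂ)⁻¹ • Matrix.vecMulVec (starRingEnd ℂ ∘ p) (starRingEnd ℂ ∘ q) := by
    rw [hπ]
    ext a b
    simp [Matrix.vecMulVec_apply, map_ofNat]
  have hmul : projOnto p * (projOnto p).map (starRingEnd ℂ) = 0 := by
    rw [hπc, hπ, Matrix.smul_mul, Matrix.mul_smul, Matrix.vecMulVec_mul_vecMulVec, hqp']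
    simp
  have hIs : Complex.I * s ≠ 0 := mul_ne_zero Complex.I_ne_zero (Complex.ofReal_ne_zero.2 hs)
  have h1 : (0 - Complex.I * s) / (0 + Complex.I * s) = -1 := by
    rw [zero_sub, zero_add, neg_div, div_self hIs]
  have h2 : (0 + Complex.I * s) / (0 - Complex.I * s) = -1 := by
    rw [zero_sub, zero_add, div_neg, div_self hIs]
  -- Both quotients are `-1` at `λ = 0`, so `q = (2π - 1)(2π̄ - 1)`, and the product term drops out.
  -- In `π + π̄` the imaginary off-diagonal blocks cancel.
  have h3 : qMap s (projOnto p) 0 =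
      1 - (2 : ℂ) • (projOnto p + (projOnto p).map (starRingEnd ℂ)) := by
    rw [qMap, h1, h2]
    generalize hP : (projOnto p).map (starRingEnd ℂ) = P at hmul ⊢
    have : (projOnto p + (-1 : ℂ) • (1 - projOnto p)) * (P + (-1 : ℂ) • (1 - P))
      = 1 - (2 : ℂ) • (projOnto p + P) + (4 : ℂ) • (projOnto p * P) := by
      simp only [neg_smul, one_smul, ← sub_eq_add_neg, sub_sub_eq_add_sub, add_mul, sub_mul, mul_add,
        mul_sub, one_mul, mul_one]
      module
    rw [this, hmul, smul_zero, add_zero]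
  have hn' : (n : ℂ) ≠ 0 := Complex.ofReal_ne_zero.2 hn
  rw [h3, hπc, hπ, hq', hp]
  ext a b
  rcases a with a | a <;> rcases b with b | b
  · simp [realBlocks, initVec, Matrix.vecMulVec_apply, Matrix.one_apply]
    field_simp
    split_ifs <;> simp <;> ring
  · simp [realBlocks, initVec, Matrix.vecMulVec_apply]
  · simp [realBlocks, initVec, Matrix.vecMulVec_apply]
  · have hI := Complex.I_sq
    simp [realBlocks, initVec, Matrix.vecMulVec_apply, Matrix.one_apply, J]
    field_simp
    fin_cases a <;> fin_cases b <;> simp <;> ring_nf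

/-- Both blocks are reflections, so `q_{s,π}(0)` is its own inverse; this removes the inverse in
`newFrame` at `λ = 0`. -/
theorem qMap_zero_mul_self (hs : s ≠ 0) {w : Amb k} {z : Fin 2 → ℝ} {n : ℝ} (hn : n ≠ 0)
    (hw : ‖w‖ ^ 2 = n) (hz : z 0 ^ 2 - z 1 ^ 2 = n) :
    qMap s (projOnto (initVec w z)) 0 * qMap s (projOnto (initVec w z)) 0 = 1 := by
  rw [qMap_zero hs hn hw hz, realBlocks_mul, ← realBlocks_one]
  have hww : w.ofLp ⬝ᵥ w.ofLp = n := by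
    rw [← hw, EuclideanSpace.real_norm_sq_eq]
    exact Finset.sum_congr rfl fun j _ => (sq _).symm
  congr 1
  · simp only [sub_mul, mul_sub, one_mul, mul_one, Matrix.smul_mul, Matrix.mul_smul,
      Matrix.vecMulVec_mul_vecMulVec, hww]
    ext a b
    simp [Matrix.vecMulVec_apply]
    field_simp
    ring
  · ext a b
    fin_cases a <;> fin_cases b <;>
      simp [Matrix.vecMulVec_apply, J, Matrix.mul_apply] <;> field_simp
    · linear_combination (4 * z 0 ^ 2) * hz
    · linear_combination (-4 * z 0 * z 1) * hz
    · linear_combination (4 * z 0 * z 1) * hz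
    · linear_combination (-4 * z 1 ^ 2) * hz

theorem IsFrame.newFrame_zero (h : IsFrame O ξ E) (hs : s ≠ 0) (hW : ‖W‖ = 1)
    (hZ : Z 0 ^ 2 - Z 1 ^ 2 = 1) (hx : x ∈ regularSet E s W Z O) {A : Matrix (Idx k) (Idx k) ℝ}
    {B : Matrix (Fin 2) (Fin 2) ℝ} (hE0 : E x 0 = realBlocks A B) :
    newFrame E s W Z x 0 = realBlocks
      (A * (1 - (2 : ℝ) • Matrix.vecMulVec (hatW E s W Z x).ofLp (hatW E s W Z x).ofLp))
      (B * (1 - (2 : ℝ) • (Matrix.vecMulVec (hatZ E s W Z x) (hatZ E s W Z x) * J ℝ))) := by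
  have hn : ‖tildeW E s W Z x‖ ≠ 0 := norm_ne_zero_iff.2 hx.2
  have hN := h.norm_tilde hW hZ (s := s) hx.1
  have hn2 := pow_ne_zero 2 hn
  rw [newFrame, h.movedVec_eq hx.1, Matrix.inv_eq_left_inv (qMap_zero_mul_self hs hn2 rfl hN.symm),
    qMap_zero hs hn2 rfl hN.symm, hE0, realBlocks_mul]
  congr 3
  · ext a b
    simp only [Matrix.smul_apply, Matrix.vecMulVec_apply, hatW, PiLp.smul_apply, smul_eq_mul]
    field_simp
  · ext a b
    simp only [Matrix.smul_apply, Matrix.vecMulVec_apply, h.hatZ_eq hW hZ hx.1, smul_eq_mul, J,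
      Matrix.mul_diagonal]
    field_simp

theorem newA_eq {A : Matrix (Idx k) (Idx k) ℝ} {B : Matrix (Fin 2) (Fin 2) ℝ}
    (h : newFrame E s W Z x 0 = realBlocks A B) : newA E s W Z x = A := by
  rw [newA, h]
  ext a b
  simp [realBlocks]

theorem newB_eq {A : Matrix (Idx k) (Idx k) ℝ} {B : Matrix (Fin 2) (Fin 2) ℝ}
    (h : newFrame E s W Z x 0 = realBlocks A B) : newB E s W Z x = B := by
  rw [newB, h]
  ext a b
  simp [realBlocks]

/-- `cosh α = (1 + z₂²)^{1/2} = |z₁|`. Moreover `z₁ - z₂ = ε e^α`, and the sign `ε` is invisible to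
`Real.log`. -/
theorem alpha_spec (hz : hatZ E s W Z x 0 ^ 2 - hatZ E s W Z x 1 ^ 2 = 1) :
    hatZ E s W Z x 0 = Real.sign (hatZ E s W Z x 0) * Real.cosh (alpha E s W Z x) ∧
    hatZ E s W Z x 1 = -(Real.sign (hatZ E s W Z x 0) * Real.sinh (alpha E s W Z x)) ∧
    alpha E s W Z x = Real.log (hatZ E s W Z x 0 - hatZ E s W Z x 1) := by
  rw [alpha, Real.sinh_arsinh, Real.cosh_arsinh, Real.arsinh]
  generalize hatZ E s W Z x 0 = a at *
  generalize hatZ E s W Z x 1 = b at *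
  have ha : a ≠ 0 := fun h0 => by
    rw [h0] at hz
    nlinarith [sq_nonneg b]
  rcases lt_or_gt_of_ne ha with h | h
  · rw [Real.sign_of_neg h]
    have e : √(1 + (-(-1 * b)) ^ 2) = -a := by
      rw [← Real.sqrt_sq (neg_nonneg.2 h.le)]
      congr 1
      linarith
    rw [e]
    refine ⟨by ring, by ring, ?_⟩
    rw [← Real.log_neg_eq_log]
    congr 1
    ring
  · rw [Real.sign_of_pos h]
    have e : √(1 + (-(1 * b)) ^ 2) = a := by
      conv_rhs => rw [← Real.sqrt_sq h.le]
      congr 1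
      linarith
    rw [e]
    refine ⟨by ring, by ring, ?_⟩
    congr 1
    ring

theorem column_mul_reflection {A A' : Plane → Matrix (Idx k) (Idx k) ℝ} {w : Plane → Amb k}
    (h : A' x = A x * (1 - (2 : ℝ) • Matrix.vecMulVec (w x).ofLp (w x).ofLp)) (j : Idx k) :
    column A' j x = column A j x - (2 * w x j) • IsDressing.direction A w x := by
  ext a
  have e : IsDressing.direction A w x a = (A x *ᵥ (w x).ofLp) a := by
    simp [IsDressing.direction, column, Matrix.mulVec, dotProduct, mul_comm]
  rw [PiLp.sub_apply, PiLp.smul_apply, e]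
  simp [column, h, Matrix.mul_sub, Matrix.mul_vecMulVec, Matrix.vecMulVec_apply]
  ring

/-- With `z = ε (cosh α, -sinh α)` the reflection is the matrix of the conclusion with `2α` in place
of `v`, and hyperbolic addition gives `v = 2α - u`. Stated through exponentials, the identity is
polynomial modulo `z₁² - z₂² = 1`. -/
theorem hypRot_mul_reflection {u : Plane → ℝ} {v : ℝ} {z : Fin 2 → ℝ} (hz : z 0 ^ 2 - z 1 ^ 2 = 1)
    (h : Real.exp v = (z 0 - z 1) ^ 2 * Real.exp (-u x))
    (h' : Real.exp (-v) = (z 0 + z 1) ^ 2 * Real.exp (u x)) :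
    hypRot u x * (1 - (2 : ℝ) • (Matrix.vecMulVec z z * J ℝ)) =
      !![-Real.cosh v, -Real.sinh v; Real.sinh v, Real.cosh v] := by
  rw [Real.cosh_eq, Real.sinh_eq, h, h', hypRot, Real.cosh_eq, Real.sinh_eq]
  set p := Real.exp (u x)
  set q := Real.exp (-u x)
  ext i j
  fin_cases i <;> fin_cases j <;> simp [Matrix.mul_apply, J, Matrix.vecMulVec_apply]
  · linear_combination (-(p + q) / 2) * hz
  · linear_combination ((q - p) / 2) * hz
  · linear_combination ((q - p) / 2) * hz
  · linear_combination (-(p + q) / 2) * hz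

end NewFrame

end Isothermic

/-! ### The Darboux transformation of an isothermic pair -/

open Isothermic in
theorem theorem13p1 (k : ℕ) (O : Set Isothermic.Plane) (hO : IsOpen O)
    -- an isothermic pair in `ℝᵐ`, `m = 2 + k`, corresponding to the solution `(u, G)`
    (u : Isothermic.Plane → ℝ) (G : Isothermic.Plane → Matrix (Fin k) (Fin 2) ℝ)
    (Y₁ Y₂ : Isothermic.Plane → Isothermic.Amb k)
    (A : Isothermic.Plane → Matrix (Isothermic.Idx k) (Isothermic.Idx k) ℝ)
    (hu : Isothermic.SolvesGaussCodazzi O u G)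
    (hY : Isothermic.IsIsothermicPairFor O Y₁ Y₂ (Isothermic.offDiag u) G (Isothermic.hypRot u) A)
    -- a frame of `ξ = (F, G)` with `E(x, 0) = diag(A, B)`
    (E : Isothermic.Plane → ℂ →
      Matrix (Isothermic.Idx k ⊕ Fin 2) (Isothermic.Idx k ⊕ Fin 2) ℂ)
    (hE : Isothermic.IsFrame O (fun x => Matrix.fromRows (Isothermic.offDiag u x) (G x)) E)
    (hE0 : ∀ x ∈ O, E x 0 = Isothermic.realBlocks (A x) (Isothermic.hypRot u x))
    -- the data of `q_{s,π}`
    (s : ℝ) (hs : s ≠ 0) (W : Isothermic.Amb k) (hW : ‖W‖ = 1)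
    (Z : Fin 2 → ℝ) (hZ : Z 0 ^ 2 - Z 1 ^ 2 = 1) :
    let Oreg := Isothermic.regularSet E s W Z O
    let Wh := Isothermic.hatW E s W Z
    let Zh := Isothermic.hatZ E s W Z
    let ε := fun x => Real.sign (Zh x 0)
    let α := Isothermic.alpha E s W Z
    let uN := Isothermic.newU E s W Z u
    let ξN := Isothermic.newXi E s W Z
      (fun x => Matrix.fromRows (Isothermic.offDiag u x) (G x))
    let FN := fun x => (ξN x).toRows₁
    let GN := fun x => (ξN x).toRows₂
    let AN := Isothermic.newA E s W Z
    let BN := Isothermic.newB E s W Z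
    let YN₁ := Isothermic.newY₁ E s W Z u A Y₁
    let YN₂ := Isothermic.newY₂ E s W Z u A Y₂
    let e := fun (a : Fin k) => Isothermic.column A (Sum.inr a)
    let eN := fun (a : Fin k) => Isothermic.column AN (Sum.inr a)
    -- the objects are well defined on the open set `Oreg`
    IsOpen Oreg ∧
    (∀ x ∈ Oreg, Isothermic.movedVec E s W Z x =
        Isothermic.initVec (Isothermic.tildeW E s W Z x) (Isothermic.tildeZ E s W Z x) ∧
      ‖Wh x‖ = 1 ∧ Zh x 0 ^ 2 - Zh x 1 ^ 2 = 1 ∧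
      Zh x 0 = ε x * Real.cosh (α x) ∧ Zh x 1 = -(ε x * Real.sinh (α x)) ∧
      Isothermic.newFrame E s W Z x 0 = Isothermic.realBlocks (AN x) (BN x)) ∧
    -- (i) the new pair is isothermic
    (Isothermic.IsIsothermicPair Oreg YN₁ YN₂ ∧
      Isothermic.IsIsothermic Oreg YN₁ ∧ Isothermic.IsIsothermic Oreg YN₂) ∧
    -- (ii) the corresponding solution
    (Isothermic.SolvesGaussCodazzi Oreg uN GN ∧
      Isothermic.IsIsothermicPairFor Oreg YN₁ YN₂ FN GN BN AN ∧
      ∀ x ∈ Oreg, FN x = Isothermic.offDiag uN x ∧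
        BN x = !![-Real.cosh (uN x), -Real.sinh (uN x); Real.sinh (uN x), Real.cosh (uN x)]) ∧
    -- (iii) the fundamental forms, with respect to the parallel normal frame `eN`
    (Isothermic.IsParallelNormalFrame YN₁ Oreg eN ∧ Isothermic.IsParallelNormalFrame YN₂ Oreg eN ∧
      Isothermic.HasForms YN₁ Oreg (fun x => Real.exp (-uN x))
        (fun x => Matrix.of fun a j => ![GN x a 0, -GN x a 1] j) eN ∧
      Isothermic.HasForms YN₂ Oreg (fun x => Real.exp (uN x)) GN eN) ∧
    -- (iv) the Darboux transformations
    (Isothermic.IsDarboux Oreg Y₁ YN₁ (Isothermic.bundleMap e eN) ∧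
      Isothermic.IsDarboux Oreg Y₂ YN₂ (Isothermic.bundleMap e eN)) := by
  intro Oreg Wh Zh ε α uN ξN FN GN AN BN YN₁ YN₂ e eN
  have hsub : Oreg ⊆ O := fun x hx => hx.1
  have hD : IsDressing Oreg (offDiag u) G s Wh Zh := hE.isDressing hO hW hZ
  have hOr : IsOpen Oreg := hD.isOpen
  have hα : ∀ x ∈ Oreg, _ := fun x hx => alpha_spec (hD.norm_z x hx)
  have hu' : ∀ x ∈ Oreg, uN x = 2 * Real.log (Zh x 0 - Zh x 1) - u x := fun x hx => by
    rw [← (hα x hx).2.2]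
    rfl
  have hF0 : ∀ x ∈ Oreg, newFrame E s W Z x 0 = _ := fun x hx =>
    hE.newFrame_zero hs hW hZ hx (hE0 x hx.1)
  have hu : SolvesGaussCodazzi Oreg u G :=
    ⟨hu.smooth_u.mono hsub, fun a b => (hu.smooth_G a b).mono hsub, fun x hx => hu.gauss x hx.1,
      fun x hx => hu.codazzi₁ x hx.1, fun x hx => hu.codazzi₂ x hx.1⟩
  -- the new solution
  have hξN : ∀ x a i, ξN x a i = if a = Sum.inl i then
      Matrix.fromRows (offDiag u x) (G x) a i else Matrix.fromRows (offDiag u x) (G x) a i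
        - 2 * s * lorentzSign i * Zh x i * Wh x a := by
    intro x a i
    simp only [ξN, newXi, Matrix.sub_apply, Matrix.smul_apply, Matrix.of_apply, J,
      Matrix.mul_diagonal, Matrix.vecMulVec_apply, smul_eq_mul]
    split_ifs
    · simp
    · fin_cases i <;> simp [Wh, Zh] <;> ring
  have hGN : ∀ x a i, GN x a i = G x a i - 2 * s * lorentzSign i * Zh x i * Wh x (Sum.inr a) :=
    fun x a i => hξN x (Sum.inr a) i
  have hrows : ∀ x, Matrix.fromRows (FN x) (GN x) = ξN x := fun x => Matrix.fromRows_toRows _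
  have hξ : ∀ x ∈ Oreg, ∀ a i, a ≠ Sum.inl i → Matrix.fromRows (FN x) (GN x) a i =
      Matrix.fromRows (offDiag u x) (G x) a i - 2 * s * lorentzSign i * Zh x i * Wh x a :=
    fun x _ a i hai => by rw [hrows, hξN, if_neg hai]
  have hFN : ∀ x ∈ Oreg, FN x = offDiag uN x := by
    intro x hx
    obtain ⟨d0, d1⟩ := hD.hasPd_newU hu.smooth_u hu' hx
    ext i j
    rw [show FN x i j = ξN x (Sum.inl i) j from rfl, hξN]
    fin_cases i <;> fin_cases j <;> simp [offDiag, d0.pd_eq, d1.pd_eq]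
  have hGC : SolvesGaussCodazzi Oreg uN GN :=
    hD.solvesGaussCodazzi hu hu' fun x _ a i => hGN x a i
  have hcosh : ∀ x ∈ Oreg, Real.exp (uN x) = (Zh x 0 - Zh x 1) ^ 2 * Real.exp (-u x) := by
    intro x hx
    have hne := hD.sub_ne_zero_of_mem hx
    rw [hu' x hx, sub_eq_add_neg, Real.exp_add, two_mul, Real.exp_add, ← sq, Real.exp_log_eq_abs hne,
      sq_abs]
  have hcosh' : ∀ x ∈ Oreg, Real.exp (-uN x) = (Zh x 0 + Zh x 1) ^ 2 * Real.exp (u x) := by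
    intro x hx
    have hz := hD.norm_z x hx
    rw [Real.exp_neg, hcosh x hx, Real.exp_neg]
    have hne := hD.sub_ne_zero_of_mem hx
    have := Real.exp_pos (u x)
    field_simp
    rw [← mul_pow, mul_comm, ← sq_sub_sq, hz, one_pow]
  have hBN : ∀ x ∈ Oreg, BN x =
      !![-Real.cosh (uN x), -Real.sinh (uN x); Real.sinh (uN x), Real.cosh (uN x)] := by
    intro x hx
    have hz := hD.norm_z x hx
    exact (newB_eq (hF0 x hx)).trans (hypRot_mul_reflection hz (hcosh x hx) (hcosh' x hx))
  -- the new frame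
  have hAN : ∀ x ∈ Oreg, ∀ j, column AN j x =
      column A j x - (2 * Wh x j) • IsDressing.direction A Wh x :=
    fun x hx j => column_mul_reflection (newA_eq (hF0 x hx)) j
  -- the adapted surfaces
  obtain ⟨hY₁, hY₂⟩ := hY.isAdapted hO
    (fun x _ i => by
      fin_cases i <;> simp [hypRot, Real.cosh_add_sinh, Real.sinh_add_cosh, Real.exp_ne_zero])
    (fun x _ i => by
      fin_cases i <;> simp [hypRot])
  replace hY₁ := hY₁.mono hOr hsub
  replace hY₂ := hY₂.mono hOr hsub
  have hc₁ : ∀ x i, -(hypRot u x 0 i + hypRot u x 1 i) = -Real.exp (u x) := fun x i => by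
    rw [← Real.cosh_add_sinh]
    fin_cases i <;> simp [hypRot]
  have hc₂ : ∀ x i, -(hypRot u x 0 i - hypRot u x 1 i) = -lorentzSign i * Real.exp (-u x) :=
    fun x i => by
      rw [← Real.cosh_sub_sinh]
      fin_cases i <;> simp [hypRot]
  simp only [hc₁, hc₂] at hY₁ hY₂
  have hZsm := hD.smooth_z
  have hdu : ∀ x ∈ Oreg, ∀ i, HasPd i u (pd i u x) x := fun x hx i =>
    hasPd_of_contDiffOn hu.smooth_u hOr hx
  -- Here `cᵢ = -e^u`, and `-1 + 2 Jᵢ zᵢ (z₁ + z₂) = Jᵢ (z₁ + z₂)²` by `z₁² - z₂² = 1`, so the new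
  -- factor is `Jᵢ e^{-ũ}`.
  have hYN₁ : IsAdapted Oreg YN₁ (fun i x => lorentzSign i * Real.exp (-uN x)) FN GN AN := by
    refine hD.isAdapted_reflected hY₁ hAN hξ
      (ρ := fun x => 2 / s * (Zh x 0 + Zh x 1) * Real.exp (u x))
      ((contDiffOn_const.mul ((hZsm 0).add (hZsm 1))).mul hu.smooth_u.exp)
      (fun x hx i => ?_) (fun x hx => rfl) (fun x hx i => ?_) fun x hx i => ?_
    · refine (((hasPd_const (2 / s)).mul ((hD.dz x hx i 0).add (hD.dz x hx i 1))).mul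
        ((hdu x hx i).scomp (Real.hasDerivAt_exp (u x)))).congr_deriv ?_
      fin_cases i <;> simp [offDiag] <;> field_simp <;> ring
    · rw [hcosh' x hx]
      have hz := hD.norm_z x hx
      field_simp
      fin_cases i <;> simp
      · linear_combination -hz
      · linear_combination -hz
    · fin_cases i <;> simp [Real.exp_ne_zero]
  -- Here `cᵢ = -Jᵢ e^{-u}`, and `-Jᵢ + 2 Jᵢ zᵢ (z₁ - z₂) = (z₁ - z₂)²`, so the new factor is
  -- `e^{ũ}` in both directions.
  have hYN₂ : IsAdapted Oreg YN₂ (fun _ x => Real.exp (uN x)) FN GN AN := by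
    refine hD.isAdapted_reflected hY₂ hAN hξ
      (ρ := fun x => 2 / s * (Zh x 0 - Zh x 1) * Real.exp (-u x))
      ((contDiffOn_const.mul ((hZsm 0).sub (hZsm 1))).mul hu.smooth_u.neg.exp)
      (fun x hx i => ?_) (fun x hx => rfl) (fun x hx i => ?_) fun x hx i => Real.exp_ne_zero _
    · refine (((hasPd_const (2 / s)).mul ((hD.dz x hx i 0).sub (hD.dz x hx i 1))).mul
        ((hdu x hx i).neg.scomp (Real.hasDerivAt_exp (-u x)))).congr_deriv ?_
      fin_cases i <;> simp [offDiag] <;> field_simp <;> ring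
    · rw [hcosh x hx]
      have hz := hD.norm_z x hx
      field_simp
      fin_cases i <;> simp
      · linear_combination -hz
      · linear_combination hz
  -- `-lorentzSign = (-1, 1)` lists the row signs of `B̃♮` relative to `hypRot`.
  have hσ : ∀ i : Fin 2, (-lorentzSign i) ^ 2 = 1 := fun i => by fin_cases i <;> simp
  have hσ' : ∀ i : Fin 2, lorentzSign i ^ 2 = 1 := fun i => by fin_cases i <;> simp
  have hII : SolvesSystemII Oreg FN GN BN :=
    hGC.solvesSystemII hOr hFN hσ fun x hx i j => by
      rw [hBN x hx]
      fin_cases i <;> fin_cases j <;> simp [hypRot]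
  have hA : ∀ x ∈ Oreg, (A x)ᵀ * A x = 1 := hY₁.orthogonal
  refine ⟨hOr, fun x hx => ⟨hE.movedVec_eq hx.1, hD.norm_w x hx, hD.norm_z x hx, (hα x hx).1,
    (hα x hx).2.1, ?_⟩, ⟨isIsothermicPair_of_isAdapted hGC hFN hYN₁ hYN₂, ?_, ?_⟩,
    ⟨hGC, ?_, fun x hx => ⟨hFN x hx, hBN x hx⟩⟩,
    ⟨hYN₁.isParallelNormalFrame, hYN₂.isParallelNormalFrame, ?_, ?_⟩, ?_, ?_⟩
  · simp only [AN, BN]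
    rw [newA_eq (hF0 x hx), newB_eq (hF0 x hx), hF0 x hx]
  · exact hYN₁.isIsothermic hGC.smooth_u.neg hσ' hGC.smooth_G fun x hx i => rfl
  · exact hYN₂.isIsothermic hGC.smooth_u (σ := fun _ => 1) (by simp) hGC.smooth_G
      fun x hx i => (one_mul _).symm
  · refine isIsothermicPairFor_of_isAdapted hII hYN₁ hYN₂ (fun x hx i => ?_) fun x hx i => ?_
    · have := Real.cosh_sub_sinh (uN x)
      rw [hBN x hx]
      fin_cases i <;> simp <;> linarith
    · have := Real.cosh_add_sinh (uN x)
      rw [hBN x hx]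
      fin_cases i <;> simp
  · refine hYN₁.hasForms (fun x hx i => by rw [mul_pow, hσ', one_mul]) fun x hx a i => ?_
    fin_cases i <;> simp
  · exact hYN₂.hasForms (fun x hx i => rfl) fun x hx a i => rfl
  · exact (hD.isReflectionPair hA hAN fun x hx => rfl).isDarboux hY₁ hYN₁ (fun x hx => rfl)
      fun x hx => by simp
  · exact (hD.isReflectionPair hA hAN fun x hx => rfl).isDarboux hY₂ hYN₂
      (fun x hx => by simp) fun x hx => rfl
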